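/- Let $I(321)$ denote the set of all permutations $\pi$ that are involutions ($\pi\circ\pi=\mathrm{id}$) and have no descending subsequence of length $3$. A permutation is simple if its only intervals (sets of consecutive positions carrying a set of consecutive values) are the empty set, the singletons and the whole set of positions. The inflation $\sigma[\tau_1,\dots,\tau_m]$ of a permutation $\sigma$ of length $m$ by non-empty permutations $\tau_i$ is obtained by replacing the $i$-th entry of $\sigma$ by a block of consecutive values order-isomorphic to $\tau_i$. The generating function of a set $S$ of permutations is $\sum_n |S_n|x^n$, where $S_n$ is the set of elements of $S$ of length $n$. Let - $\alpha$ be the generating function of the $\pi\in I(321)$ that are inflations of $12$ (the sum-decomposable ones), - $\gamma$ be the generating function of the simple $\pi\in I(321)$ of length $>2$, - $\delta$ be the generating function of the $\pi\in I(321)$ that are inflations of a simple involution of length $>2$ and strictly less than the length of $\pi$ (proper inflations), - $\zeta=\gamma+\delta$. Below, $\sqrt{P}$ denotes the formal power series with constant term $1$ whose square is $P$ (and $P$ has constant term $1$). (i) $\alpha$ is algebraic over $\mathbb{Q}(x)$; it satisfies $$\alpha+\alpha x+\alpha^2x-x^2-4\alpha x^2-2\alpha^2x^2-4x^3-4\alpha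 x^3-4x^4=0$$ and $$\alpha=\frac{1+x-4x^2-4x^3-\sqrt{1+2x-7x^2-12x^3+16x^4+16x^5-16x^6}}{2(-x+2x^2)}.$$ Its coefficients at $x^0$ and $x^1$ vanish, and those at $x^2,\dots,x^{20}$ are $1, 3, 5, 10, 18, 35, 65, 126, 238, 462, 882, 1716, 3300, 6435, 12441, 24310, 47190, 92378, 179894$. (ii) $\zeta$ is algebraic over $\mathbb{Q}(x)$; it satisfies $$(-1+4x^2-3x^4)\,\zeta+(1-2x^2+x^4)\,\zeta^2+x^6=0$$ and $$\zeta=\frac{1-4x^2+3x^4-\sqrt{1-8x^2+22x^4-28x^6+17x^8-4x^{10}}}{2(1-2x^2+x^4)}.$$ The constant coefficient and all coefficients of odd powers of $x$ in $\zeta$ vanish, and for every $m\ge 0$ the coefficient of $x^{2m+2}$ is $C_m-1$, where $C_m=\frac1{m+1}\binom{2m}{m}$ is the $m$-th Catalan number. In particular the nonzero coefficients are the Catalan numbers diminished by one: $1,4,13,41,131,428,1429,4861,\dots$, at $x^6,x^8,x^{10},\dots$. -/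

import Mathlib

open PowerSeries

namespace Inv321

/-- `π` has no descending subsequence of length 3. -/
def Avoids321 {n : ℕ} (π : Equiv.Perm (Fin n)) : Prop :=
  ¬ ∃ i j k : Fin n, i < j ∧ j < k ∧ π k < π j ∧ π j < π i

/-- The set `I(321)_n` of the involutions of length `n` that avoid the pattern 321. -/
def I321 (n : ℕ) : Set (Equiv.Perm (Fin n)) :=
  {π | Function.Involutive π ∧ Avoids321 π}

/-- An interval of `π`: a set of contiguous indices whose set of values is contiguous. -/
def IsInterval {n : ℕ} (π : Equiv.Perm (Fin n)) (I : Set (Fin n)) : Prop :=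
  I.OrdConnected ∧ (π '' I).OrdConnected

/-- `π` is simple: its only intervals are the empty one, the singletons and the whole. -/
def IsSimple {n : ℕ} (π : Equiv.Perm (Fin n)) : Prop :=
  ∀ I : Set (Fin n), IsInterval π I → I.Subsingleton ∨ I = Set.univ

/-- `π = σ[τ₁, …, τₘ]`, where `τ i` has length `k i ≥ 1`: the `t`-th place of the `i`-th block
carries the `τ i t`-th value of a block of `k i` consecutive values, the blocks of places
being in the natural order and the blocks of values in the order prescribed by `σ`
(places and values are counted from 0). -/
def IsInflation {n m : ℕ} (π : Equiv.Perm (Fin n)) (σ : Equiv.Perm (Fin m))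
    (k : Fin m → ℕ) (τ : ∀ i, Equiv.Perm (Fin (k i))) : Prop :=
  (∀ i, 0 < k i) ∧ ∑ i, k i = n ∧
    ∀ (i : Fin m) (t : Fin (k i)) (x : Fin n),
      (x : ℕ) = (∑ j with j < i, k j) + (t : ℕ) →
        (π x : ℕ) = (∑ j with σ j < σ i, k j) + (τ i t : ℕ)

/-- `π` is an inflation of `σ`. -/
def IsInflationOf {n m : ℕ} (π : Equiv.Perm (Fin n)) (σ : Equiv.Perm (Fin m)) : Prop :=
  ∃ (k : Fin m → ℕ) (τ : ∀ i, Equiv.Perm (Fin (k i))), IsInflation π σ k τ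

/-- The generating function `∑ |S_n| x^n` of a set `S` of permutations graded by length. -/
noncomputable def genFun (S : ∀ n : ℕ, Set (Equiv.Perm (Fin n))) : ℚ⟦X⟧ :=
  PowerSeries.mk fun n => ((S n).ncard : ℚ)

/-- The elements of `I(321)` of type 12, i.e. the inflations of 12 (sum decomposable). -/
def sumDecomposable (n : ℕ) : Set (Equiv.Perm (Fin n)) :=
  {π | π ∈ I321 n ∧ IsInflationOf π (1 : Equiv.Perm (Fin 2))}

/-- The simple elements of `I(321)` of length greater than 2. -/
def simpleInv (n : ℕ) : Set (Equiv.Perm (Fin n)) :=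
  {π | π ∈ I321 n ∧ 2 < n ∧ IsSimple π}

/-- The elements of `I(321)` that are inflations of a simple involution of length greater
than 2, in which some entry is really inflated (`m < n`). -/
def inflatedSimpleInv (n : ℕ) : Set (Equiv.Perm (Fin n)) :=
  {π | π ∈ I321 n ∧ ∃ (m : ℕ) (σ : Equiv.Perm (Fin m)), 2 < m ∧ m < n ∧
    IsSimple σ ∧ Function.Involutive σ ∧ IsInflationOf π σ}

noncomputable def alphaGF : ℚ⟦X⟧ := genFun sumDecomposable

noncomputable def gammaGF : ℚ⟦X⟧ := genFun simpleInv

noncomputable def deltaGF : ℚ⟦X⟧ := genFun inflatedSimpleInv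

noncomputable def zetaGF : ℚ⟦X⟧ := gammaGF + deltaGF

/-- `s` is the formal square root `√p`, on the branch with constant term 1. -/
def IsSqrt (p s : ℚ⟦X⟧) : Prop :=
  s ^ 2 = p ∧ PowerSeries.constantCoeff s = 1

end Inv321

namespace Inv321

/-! A fixed point `i` of a 321-avoiding involution separates the places below it from those above:
if `x < i < π x`, then `x, i, π x` carry `π x, i, x`. So, apart from the permutation of length 1,
every sum indecomposable element of `I(321)` is fixed point free.

A fixed point free element maps its excedances increasingly onto the other places, hence is
determined by the set of excedances. Reading excedances as up steps gives all Dyck words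
(`dyckWord_bijective`), so the generating function `F` of these elements satisfies `F = 1 + X^2
F^2`. Splitting off the first indecomposable summand (`SumClosed.genFun_eq`) gives `F = 1 + P F` for
the indecomposable ones, whence `P = X^2 F`. The same splitting in `I321`, with indecomposables `X +
P`, yields the equation of `alphaGF`.

For `zetaGF`: in a sum indecomposable 321-avoider a proper interval contains no inversion, so it is
a run of consecutive values at consecutive places. Contracting the maximal runs leaves an involution
that is simple of length > 2 unless `π` is skew decomposable (`exists_simple_blockMap`). Conversely,
inflations of simple permutations of length > 2 are neither sum nor skew decomposable. Exactly one
skew decomposable element exists in each positive even length, so `zetaGF` is `P` less `X^2/(1 -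
X^2)`. -/

/-! ### Inflations as block maps -/

open Finset in
-- With `k` as block lengths, block `i` ends before block `i'` starts in the order given by `g`: `g
-- = σ` serves the values, `g = 1` the places.
theorem sum_lower_add_le {m : ℕ} (g : Equiv.Perm (Fin m)) (k : Fin m → ℕ) {i i' : Fin m}
    (h : g i < g i') :
    (∑ j with g j < g i, k j) + k i ≤ ∑ j with g j < g i', k j := by
  have hi : i ∉ univ.filter (fun j => g j < g i) := by simp
  rw [add_comm, ← sum_insert hi]
  refine sum_le_sum_of_subset fun j hj => ?_
  simp only [mem_insert, mem_filter, mem_univ, true_and] at hj ⊢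
  rcases hj with rfl | hj
  · exact h
  · exact hj.trans h

open Finset in
theorem sum_lower_add_le_sum {m : ℕ} (g : Equiv.Perm (Fin m)) (k : Fin m → ℕ) (i : Fin m) :
    (∑ j with g j < g i, k j) + k i ≤ ∑ j, k j := by
  have hi : i ∉ univ.filter (fun j => g j < g i) := by simp
  rw [add_comm, ← sum_insert hi]
  exact sum_le_sum_of_subset (subset_univ _)

theorem sum_lt_add_le {m : ℕ} (k : Fin m → ℕ) {i i' : Fin m} (h : i < i') :
    (∑ j with j < i, k j) + k i ≤ ∑ j with j < i', k j := by
  convert sum_lower_add_le 1 k h <;> rfl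

theorem sum_lt_add_le_sum {m : ℕ} (k : Fin m → ℕ) (i : Fin m) :
    (∑ j with j < i, k j) + k i ≤ ∑ j, k j := by
  convert sum_lower_add_le_sum 1 k i <;> rfl

open Finset in
theorem exists_block {m : ℕ} (k : Fin m → ℕ) {x : ℕ} (hx : x < ∑ i, k i) :
    ∃ (i : Fin m) (t : Fin (k i)), x = (∑ j with j < i, k j) + (t : ℕ) := by
  obtain ⟨⟨i, t⟩, h⟩ := (finSigmaFinEquiv (n := k)).surjective ⟨x, hx⟩
  refine ⟨i, t, ?_⟩
  have h' := congrArg Fin.val h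
  rw [finSigmaFinEquiv_apply] at h'
  simp only at h'
  rw [← h']
  congr 1
  -- `finSigmaFinEquiv` sums over `Fin i`, the goal over the indices below `i` in `Fin m`.
  refine sum_bij (fun a _ => Fin.castLE i.2.le a) ?_ ?_ ?_ ?_
  · intro a _
    simpa using Fin.lt_def.2 a.2
  · intro a _ b _ hab
    simpa using hab
  · intro b hb
    exact ⟨⟨b, Fin.lt_def.1 (by simpa using hb)⟩, by simp, by ext; simp⟩
  · intro a _
    rfl

/-- `f` sends a place to the block that holds it. -/
def IsBlockMap {n m : ℕ} (π : Equiv.Perm (Fin n)) (σ : Equiv.Perm (Fin m))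
    (f : Fin n → Fin m) : Prop :=
  Monotone f ∧ Function.Surjective f ∧ ∀ x y, σ (f x) < σ (f y) → π x < π y

theorem IsInflationOf.exists_isBlockMap {n m : ℕ} {π : Equiv.Perm (Fin n)}
    {σ : Equiv.Perm (Fin m)} (h : IsInflationOf π σ) : ∃ f, IsBlockMap π σ f := by
  obtain ⟨k, τ, hk, hs, h⟩ := h
  have key : ∀ x : Fin n, ∃ (i : Fin m) (t : Fin (k i)),
      (x : ℕ) = (∑ j with j < i, k j) + (t : ℕ) := fun x => exists_block k (hs ▸ x.2)
  choose f t ht using key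
  have lt_of : ∀ (x y : Fin n) (i j : Fin m) (s : Fin (k i)) (u : Fin (k j)),
      (x : ℕ) = (∑ j with j < i, k j) + (s : ℕ) →
      (y : ℕ) = (∑ l with l < j, k l) + (u : ℕ) → i < j → x < y := by
    intro x y i j s u hx hy hij
    have := sum_lt_add_le k hij
    have := s.2
    rw [Fin.lt_def]
    omega
  refine ⟨f, ?_, ?_, ?_⟩
  · intro x y hxy
    by_contra hc
    exact absurd (lt_of y x _ _ _ _ (ht y) (ht x) (not_le.1 hc)) (not_lt.2 hxy)
  · intro i
    have hlt : (∑ j with j < i, k j) < n := by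
      have := sum_lt_add_le_sum k i
      have := hk i
      omega
    refine ⟨⟨_, hlt⟩, ?_⟩
    set x : Fin n := ⟨_, hlt⟩ with hx
    have hx' : (x : ℕ) = (∑ j with j < i, k j) + ((⟨0, hk i⟩ : Fin (k i)) : ℕ) := by simp [hx]
    rcases lt_trichotomy (f x) i with hc | hc | hc
    · exact absurd (lt_of x x _ _ _ _ (ht x) hx' hc) (lt_irrefl _)
    · exact hc
    · exact absurd (lt_of x x _ _ _ _ hx' (ht x) hc) (lt_irrefl _)
  · intro x y hxy
    have h1 := h _ _ _ (ht x)
    have h2 := h _ _ _ (ht y)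
    have := sum_lower_add_le σ k hxy
    have := (τ (f x) (t x)).2
    rw [Fin.lt_def]
    omega

open Finset in
theorem card_perm_lt {n : ℕ} (π : Equiv.Perm (Fin n)) (x : Fin n) :
    #{y | π y < π x} = (π x : ℕ) := by
  rw [← Fin.card_Iio (π x)]
  refine card_bij (fun y _ => π y) ?_ ?_ ?_
  · intro a ha
    simpa using ha
  · intro a _ b _ hab
    exact π.injective hab
  · intro b hb
    exact ⟨π.symm b, by simpa using hb, by simp⟩

open Finset in
theorem card_fiber_lower {n m : ℕ} (f : Fin n → Fin m) (p : Fin m → Prop) [DecidablePred p] :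
    #{y | p (f y)} = ∑ j with p j, #{y | f y = j} := by
  rw [card_eq_sum_card_fiberwise (f := f) (t := univ.filter p)]
  · refine sum_congr rfl fun j hj => ?_
    congr 1
    ext y
    simp only [mem_filter, mem_univ, true_and] at hj ⊢
    exact ⟨fun h => h.2, fun h => ⟨h ▸ hj, h⟩⟩
  · intro y hy
    simpa using hy

open Finset in
-- A value equals the number of places carrying smaller values; these lie in blocks that `σ` puts
-- lower, or in the block of `x` itself.
theorem IsBlockMap.card_lower {n m : ℕ} {π : Equiv.Perm (Fin n)} {σ : Equiv.Perm (Fin m)}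
    {f : Fin n → Fin m} (hf : IsBlockMap π σ f) (x : Fin n) :
    (π x : ℕ) = (∑ j with σ j < σ (f x), #{y | f y = j}) + #{y | f y = f x ∧ π y < π x} := by
  rw [← card_perm_lt, ← card_fiber_lower f (fun j => σ j < σ (f x)), ← card_union_of_disjoint]
  · congr 1
    ext y
    simp only [mem_filter, mem_univ, true_and, mem_union]
    constructor
    · intro h
      rcases lt_trichotomy (σ (f y)) (σ (f x)) with hc | hc | hc
      · exact Or.inl hc
      · exact Or.inr ⟨σ.injective hc, h⟩
      · exact absurd (hf.2.2 _ _ hc) h.not_gt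
    · rintro (h | h)
      · exact hf.2.2 _ _ h
      · exact h.2
  · rw [disjoint_left]
    intro y hy hy'
    simp only [mem_filter, mem_univ, true_and] at hy hy'
    rw [hy'.1] at hy
    exact lt_irrefl _ hy

open Finset in
theorem IsBlockMap.isInflationOf {n m : ℕ} {π : Equiv.Perm (Fin n)} {σ : Equiv.Perm (Fin m)}
    {f : Fin n → Fin m} (hf : IsBlockMap π σ f) : IsInflationOf π σ := by
  -- The case of identities, in which `card_lower` counts places instead of values.
  have hid : IsBlockMap 1 1 f :=
    ⟨hf.1, hf.2.1, fun x y h => lt_of_not_ge fun hc => (hf.1 hc).not_gt h⟩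
  let k : Fin m → ℕ := fun i => #{y | f y = i}
  have card_lt : ∀ (ρ : Equiv.Perm (Fin n)) (x : Fin n),
      #{y | f y = f x ∧ ρ y < ρ x} < k (f x) := by
    intro ρ x
    refine card_lt_card ⟨fun y hy => ?_, fun hc => ?_⟩
    · simp only [mem_filter, mem_univ, true_and] at hy ⊢
      exact hy.1
    · have := hc (show x ∈ _ by simp)
      simp at this
  have ksum : ∑ i, k i = n := by
    have := card_fiber_lower f (fun _ => True)
    simpa using this.symm
  have blk : ∀ (i : Fin m) (t : Fin (k i)) (x : Fin n),
      (x : ℕ) = (∑ j with j < i, k j) + (t : ℕ) → f x = i := by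
    intro i t x hx
    have h1 : (x : ℕ) = (∑ j with j < f x, k j) + #{y | f y = f x ∧ y < x} := by
      convert hid.card_lower x <;> rfl
    have h2 : #{y | f y = f x ∧ y < x} < k (f x) := by
      convert card_lt 1 x <;> rfl
    have h3 := t.2
    rcases lt_trichotomy (f x) i with hc | hc | hc
    · have := sum_lt_add_le k hc
      omega
    · exact hc
    · have := sum_lt_add_le k hc
      omega
  have hlt : ∀ (i : Fin m) (t : Fin (k i)), (∑ j with j < i, k j) + (t : ℕ) < n := by
    intro i t
    have := sum_lt_add_le_sum k i
    have := t.2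
    omega
  let pt : ∀ (i : Fin m) (t : Fin (k i)), Fin n := fun i t => ⟨_, hlt i t⟩
  have hpt : ∀ i t, f (pt i t) = i := fun i t => blk i t _ rfl
  -- The rank of a value within its block.
  let τ₀ : ∀ i, Fin (k i) → Fin (k i) := fun i t =>
    ⟨#{y | f y = i ∧ π y < π (pt i t)}, by
      have := card_lt π (pt i t)
      simpa only [hpt] using this⟩
  have inj : ∀ i, Function.Injective (τ₀ i) := by
    intro i t u htu
    have h1 := hf.card_lower (pt i t)
    have h2 := hf.card_lower (pt i u)
    simp only [hpt] at h1 h2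
    have h3 := congrArg Fin.val htu
    simp only [τ₀] at h3
    have h4 : pt i t = pt i u := π.injective (Fin.ext (by omega))
    have h5 := congrArg Fin.val h4
    simp only [pt] at h5
    exact Fin.ext (by omega)
  refine ⟨k, fun i => Equiv.ofBijective (τ₀ i) (Finite.injective_iff_bijective.1 (inj i)),
    ?_, ksum, ?_⟩
  · intro i
    obtain ⟨x, hx⟩ := hf.2.1 i
    exact card_pos.2 ⟨x, by simpa using hx⟩
  · intro i t x hx
    have hx' : x = pt i t := Fin.ext hx
    subst hx'
    have := hf.card_lower (pt i t)
    simp only [hpt] at this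
    simpa [τ₀] using this

/-- Block maps involve no block lengths and no dependent `Fin` types; the arguments about inflations
below go through them. -/
theorem isInflationOf_iff {n m : ℕ} {π : Equiv.Perm (Fin n)} {σ : Equiv.Perm (Fin m)} :
    IsInflationOf π σ ↔ ∃ f, IsBlockMap π σ f :=
  ⟨fun h => h.exists_isBlockMap, fun ⟨_, h⟩ => h.isInflationOf⟩

/-- `π` is the direct sum of two non-empty permutations, the first of which has places `L`. -/
def SumDec {n : ℕ} (π : Equiv.Perm (Fin n)) : Prop :=
  ∃ L : Set (Fin n), L.Nonempty ∧ Lᶜ.Nonempty ∧ ∀ x ∈ L, ∀ y ∉ L, x < y ∧ π x < π y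

/-- `π` is the skew sum of two non-empty permutations, the first of which has places `L`. -/
def SkewDec {n : ℕ} (π : Equiv.Perm (Fin n)) : Prop :=
  ∃ L : Set (Fin n), L.Nonempty ∧ Lᶜ.Nonempty ∧ ∀ x ∈ L, ∀ y ∉ L, x < y ∧ π y < π x

/-! ### Inflations of simple permutations are indecomposable -/

section BlockMap

variable {n m : ℕ} {π : Equiv.Perm (Fin n)} {σ : Equiv.Perm (Fin m)} {f : Fin n → Fin m}

theorem isInterval_iff {I : Set (Fin n)} :
    IsInterval π I ↔ (∀ x ∈ I, ∀ z ∈ I, ∀ y, x < y → y < z → y ∈ I) ∧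
      ∀ x ∈ I, ∀ z ∈ I, ∀ y, π x < π y → π y < π z → y ∈ I := by
  constructor
  · rintro ⟨h1, h2⟩
    refine ⟨fun x hx z hz y hxy hyz => h1.out hx hz ⟨hxy.le, hyz.le⟩,
      fun x hx z hz y hxy hyz => ?_⟩
    exact (π.injective.mem_set_image).1
      (h2.out (Set.mem_image_of_mem π hx) (Set.mem_image_of_mem π hz) ⟨hxy.le, hyz.le⟩)
  · rintro ⟨h1, h2⟩
    refine ⟨⟨fun x hx z hz y hy => ?_⟩, ⟨?_⟩⟩
    · rcases hy.1.eq_or_lt with rfl | hxy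
      · exact hx
      rcases hy.2.eq_or_lt with rfl | hyz
      · exact hz
      exact h1 x hx z hz y hxy hyz
    · rintro _ ⟨x, hx, rfl⟩ _ ⟨z, hz, rfl⟩ v hv
      obtain ⟨y, rfl⟩ := π.surjective v
      refine Set.mem_image_of_mem π ?_
      rcases hv.1.eq_or_lt with hxy | hxy
      · exact π.injective hxy ▸ hx
      rcases hv.2.eq_or_lt with hyz | hyz
      · exact π.injective hyz ▸ hz
      exact h2 x hx z hz y hxy hyz

theorem IsBlockMap.lt_of_lt (hf : IsBlockMap π σ f) {x y : Fin n} (h : f x < f y) : x < y :=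
  lt_of_not_ge fun hc => (hf.1 hc).not_gt h

theorem IsBlockMap.isInterval_image (hf : IsBlockMap π σ f) {I : Set (Fin n)}
    (hI : IsInterval π I) : IsInterval σ (f '' I) := by
  rw [isInterval_iff] at hI ⊢
  constructor
  · rintro _ ⟨x, hx, rfl⟩ _ ⟨z, hz, rfl⟩ j h1 h2
    obtain ⟨y, rfl⟩ := hf.2.1 j
    exact ⟨y, hI.1 x hx z hz y (hf.lt_of_lt h1) (hf.lt_of_lt h2), rfl⟩
  · rintro _ ⟨x, hx, rfl⟩ _ ⟨z, hz, rfl⟩ j h1 h2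
    obtain ⟨y, rfl⟩ := hf.2.1 j
    exact ⟨y, hI.2 x hx z hz y (hf.2.2 _ _ h1) (hf.2.2 _ _ h2), rfl⟩

/-- A block outside the image lies wholly in the complement of `I`, so betweenness lifts along `f`.
-/
theorem IsBlockMap.isInterval_compl_image (hf : IsBlockMap π σ f) {I : Set (Fin n)}
    (hI : IsInterval π Iᶜ) : IsInterval σ (f '' I)ᶜ := by
  rw [isInterval_iff] at hI ⊢
  have mem : ∀ x, f x ∈ (f '' I)ᶜ → x ∈ Iᶜ := fun x hx hc => hx ⟨x, hc, rfl⟩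
  constructor
  · rintro i hi l hl j h1 h2 ⟨y, hy, rfl⟩
    obtain ⟨x, rfl⟩ := hf.2.1 i
    obtain ⟨z, rfl⟩ := hf.2.1 l
    exact hI.1 x (mem x hi) z (mem z hl) y (hf.lt_of_lt h1) (hf.lt_of_lt h2) hy
  · rintro i hi l hl j h1 h2 ⟨y, hy, rfl⟩
    obtain ⟨x, rfl⟩ := hf.2.1 i
    obtain ⟨z, rfl⟩ := hf.2.1 l
    exact hI.2 x (mem x hi) z (mem z hl) y (hf.2.2 _ _ h1) (hf.2.2 _ _ h2) hy

theorem IsBlockMap.isInterval_fiber (hf : IsBlockMap π σ f) (i : Fin m) :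
    IsInterval π (f ⁻¹' {i}) := by
  rw [isInterval_iff]
  constructor
  · rintro x rfl z hz y h1 h2
    exact le_antisymm ((hf.1 h2.le).trans_eq hz) (hf.1 h1.le)
  · rintro x rfl z hz y h1 h2
    rcases lt_trichotomy (σ (f y)) (σ (f x)) with hc | hc | hc
    · exact absurd (hf.2.2 _ _ hc) h1.not_gt
    · exact σ.injective hc
    · rw [← show f z = f x from hz] at hc
      exact absurd (hf.2.2 _ _ hc) h2.not_gt

theorem false_of_subsingleton (hm : 2 < m) {A : Set (Fin m)} (h : A.Subsingleton)
    (h' : Aᶜ.Subsingleton) : False := by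
  have h01 : (⟨0, by omega⟩ : Fin m) ≠ ⟨1, by omega⟩ := by simp
  have h02 : (⟨0, by omega⟩ : Fin m) ≠ ⟨2, by omega⟩ := by simp
  have h12 : (⟨1, by omega⟩ : Fin m) ≠ ⟨2, by omega⟩ := by simp
  by_cases h0 : (⟨0, by omega⟩ : Fin m) ∈ A <;> by_cases h1 : (⟨1, by omega⟩ : Fin m) ∈ A <;>
    by_cases h2 : (⟨2, by omega⟩ : Fin m) ∈ A
  all_goals first
    | exact h01 (h h0 h1) | exact h01 (h' h0 h1) | exact h02 (h h0 h2) | exact h02 (h' h0 h2)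
    | exact h12 (h h1 h2) | exact h12 (h' h1 h2)

/-- The image of `L` and its complement are both intervals of `σ`; as `m > 2` they are not both
subsingletons, so simplicity makes the image everything. The same holds for `Lᶜ`. But `L` lies to
the left of `Lᶜ`, so monotonicity of `f` would give `i ≤ j` for all `i, j`. -/
theorem IsBlockMap.false_of_cut (hf : IsBlockMap π σ f) (hσ : IsSimple σ) (hm : 2 < m)
    {L : Set (Fin n)} (hL : L.Nonempty) (hL' : Lᶜ.Nonempty) (hlt : ∀ x ∈ L, ∀ y ∉ L, x < y)
    (h : IsInterval π L) (h' : IsInterval π Lᶜ) : False := by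
  have key : ∀ A : Set (Fin m), A.Nonempty → IsInterval σ A → IsInterval σ Aᶜ →
      A = Set.univ := by
    intro A hA h1 h2
    rcases hσ _ h1 with h1 | h1
    · rcases hσ _ h2 with h2 | h2
      · exact (false_of_subsingleton hm h1 h2).elim
      · obtain ⟨a, ha⟩ := hA
        exact absurd ha (h2 ▸ Set.mem_univ a : a ∈ Aᶜ)
    · exact h1
  have hA := key _ (hL.image f) (hf.isInterval_image h) (hf.isInterval_compl_image h')
  have hB := key _ (hL'.image f) (hf.isInterval_image h')
    (hf.isInterval_compl_image (by rwa [compl_compl]))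
  have all : ∀ i j : Fin m, i ≤ j := by
    intro i j
    obtain ⟨x, hx, rfl⟩ : i ∈ f '' L := hA ▸ Set.mem_univ i
    obtain ⟨y, hy, rfl⟩ : j ∈ f '' Lᶜ := hB ▸ Set.mem_univ j
    exact hf.1 (hlt x hx y hy).le
  have := all ⟨1, by omega⟩ ⟨0, by omega⟩
  simp [Fin.le_def] at this

theorem SumDec.exists_cut (h : SumDec π) : ∃ L : Set (Fin n), L.Nonempty ∧ Lᶜ.Nonempty ∧
    (∀ x ∈ L, ∀ y ∉ L, x < y) ∧ IsInterval π L ∧ IsInterval π Lᶜ := by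
  obtain ⟨L, h1, h2, h⟩ := h
  refine ⟨L, h1, h2, fun x hx y hy => (h x hx y hy).1, ?_, ?_⟩ <;> rw [isInterval_iff]
  · refine ⟨fun x hx z hz y h1 h2 => ?_, fun x hx z hz y h1 h2 => ?_⟩ <;> by_contra hy
    · exact h2.not_gt (h z hz y hy).1
    · exact h2.not_gt (h z hz y hy).2
  · exact ⟨fun x hx z hz y h1 h2 hy => h1.not_gt (h y hy x hx).1,
      fun x hx z hz y h1 h2 hy => h1.not_gt (h y hy x hx).2⟩

theorem SkewDec.exists_cut (h : SkewDec π) : ∃ L : Set (Fin n), L.Nonempty ∧ Lᶜ.Nonempty ∧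
    (∀ x ∈ L, ∀ y ∉ L, x < y) ∧ IsInterval π L ∧ IsInterval π Lᶜ := by
  obtain ⟨L, h1, h2, h⟩ := h
  refine ⟨L, h1, h2, fun x hx y hy => (h x hx y hy).1, ?_, ?_⟩ <;> rw [isInterval_iff]
  · refine ⟨fun x hx z hz y h1 h2 => ?_, fun x hx z hz y h1 h2 => ?_⟩ <;> by_contra hy
    · exact h2.not_gt (h z hz y hy).1
    · exact h1.not_gt (h x hx y hy).2
  · exact ⟨fun x hx z hz y h1 h2 hy => h1.not_gt (h y hy x hx).1,
      fun x hx z hz y h1 h2 hy => h2.not_gt (h y hy z hz).2⟩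

theorem IsBlockMap.not_sumDec (hf : IsBlockMap π σ f) (hσ : IsSimple σ) (hm : 2 < m) :
    ¬ SumDec π := fun h => by
  obtain ⟨L, h1, h2, h3, h4, h5⟩ := h.exists_cut
  exact hf.false_of_cut hσ hm h1 h2 h3 h4 h5

theorem IsBlockMap.not_skewDec (hf : IsBlockMap π σ f) (hσ : IsSimple σ) (hm : 2 < m) :
    ¬ SkewDec π := fun h => by
  obtain ⟨L, h1, h2, h3, h4, h5⟩ := h.exists_cut
  exact hf.false_of_cut hσ hm h1 h2 h3 h4 h5

theorem isBlockMap_id (π : Equiv.Perm (Fin n)) : IsBlockMap π π id :=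
  ⟨monotone_id, Function.surjective_id, fun _ _ h => h⟩

/-- By pigeonhole some block has two places; it is an interval, and not the whole because there are
other blocks. -/
theorem IsBlockMap.not_isSimple (hf : IsBlockMap π σ f) (hm : 2 < m) (hmn : m < n) :
    ¬ IsSimple π := by
  intro h
  obtain ⟨x, y, hxy, he⟩ := Fintype.exists_ne_map_eq_of_card_lt f (by simpa using hmn)
  rcases h _ (hf.isInterval_fiber (f y)) with hc | hc
  · exact hxy (hc he rfl)
  · have all : ∀ i, i = f y := fun i => by
      obtain ⟨z, rfl⟩ := hf.2.1 i
      exact (hc ▸ Set.mem_univ z : z ∈ f ⁻¹' {f y})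
    have := (all ⟨1, by omega⟩).trans (all ⟨0, by omega⟩).symm
    simp at this

theorem IsBlockMap.isSimple_of_eq (hf : IsBlockMap π σ f) (hσ : IsSimple σ) (hmn : m = n) :
    IsSimple π := by
  subst hmn
  have hinj : Function.Injective f := Finite.injective_iff_surjective.2 hf.2.1
  intro I hI
  rcases hσ _ (hf.isInterval_image hI) with h | h
  · exact Or.inl fun x hx y hy => hinj (h ⟨x, hx, rfl⟩ ⟨y, hy, rfl⟩)
  · refine Or.inr (Set.eq_univ_of_forall fun x => ?_)
    exact hinj.mem_set_image.1 (h ▸ Set.mem_univ (f x))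

theorem IsBlockMap.le (hf : IsBlockMap π σ f) : m ≤ n := by
  simpa using Fintype.card_le_of_surjective f hf.2.1

theorem IsBlockMap.sumDec_or_skewDec {σ : Equiv.Perm (Fin 2)} {f : Fin n → Fin 2}
    (hf : IsBlockMap π σ f) : (σ 0 < σ 1 ∧ SumDec π) ∨ (σ 1 < σ 0 ∧ SkewDec π) := by
  have ne : (f ⁻¹' {0}).Nonempty := hf.2.1 0
  have ne' : (f ⁻¹' {0})ᶜ.Nonempty := by
    obtain ⟨x, hx⟩ := hf.2.1 1
    exact ⟨x, by simp [hx]⟩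
  have one : ∀ y, y ∉ f ⁻¹' {0} → f y = 1 := fun y hy => Fin.eq_one_of_ne_zero _ hy
  have lt : ∀ x ∈ f ⁻¹' {0}, ∀ y ∉ f ⁻¹' {0}, x < y := fun x hx y hy =>
    hf.lt_of_lt (by rw [one y hy, show f x = 0 from hx]; simp)
  rcases lt_or_gt_of_ne (σ.injective.ne (zero_ne_one (α := Fin 2))) with h | h
  · refine Or.inl ⟨h, _, ne, ne', fun x hx y hy => ⟨lt x hx y hy, hf.2.2 _ _ ?_⟩⟩
    rwa [one y hy, show f x = 0 from hx]
  · refine Or.inr ⟨h, _, ne, ne', fun x hx y hy => ⟨lt x hx y hy, hf.2.2 _ _ ?_⟩⟩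
    rwa [one y hy, show f x = 0 from hx]

theorem isInflationOf_one_iff : IsInflationOf π (1 : Equiv.Perm (Fin 2)) ↔ SumDec π := by
  rw [isInflationOf_iff]
  constructor
  · rintro ⟨f, hf⟩
    rcases hf.sumDec_or_skewDec with h | h
    · exact h.2
    · exact absurd h.1 (by simp)
  · rintro ⟨L, ⟨x₀, h0⟩, ⟨x₁, h1⟩, h⟩
    classical
    refine ⟨fun x => if x ∈ L then 0 else 1, fun x y hxy => ?_, fun i => ?_, fun x y hxy => ?_⟩
    · by_cases hx : x ∈ L
      · simp [hx]
      · by_cases hy : y ∈ L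
        · exact absurd (h y hy x hx).1 hxy.not_gt
        · simp [hx, hy]
    · rcases Fin.exists_fin_two.1 ⟨i, rfl⟩ with rfl | rfl
      · exact ⟨x₀, by simp [h0]⟩
      · exact ⟨x₁, by simpa using h1⟩
    · by_cases hx : x ∈ L <;> by_cases hy : y ∈ L <;> simp [hx, hy] at hxy
      exact (h x hx y hy).2

end BlockMap

/-! ### Intervals of 321-avoiders and the contraction of runs -/

section Runs

variable {n : ℕ} {π : Equiv.Perm (Fin n)}

/-- A place left of `I` with a value above `I`, or right of `I` with a value below, would complete
the inversion to a 321. Hence `I` is a direct summand, and a cut at one of its ends is proper. -/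
theorem Avoids321.sumDec_of_inversion (hπ : Avoids321 π) {I : Set (Fin n)}
    (hI : IsInterval π I) (hne : I ≠ Set.univ) {i j : Fin n} (hi : i ∈ I) (hj : j ∈ I)
    (hij : i < j) (hinv : π j < π i) : SumDec π := by
  rw [isInterval_iff] at hI
  have left : ∀ x ∉ I, x < i → ∀ y ∈ I, x < y ∧ π x < π y := by
    intro x hx hxi y hy
    refine ⟨?_, ?_⟩
    · rcases lt_trichotomy x y with h | h | h
      · exact h
      · exact absurd (h ▸ hy) hx
      · exact absurd (hI.1 y hy i hi x h hxi) hx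
    · by_contra hc
      have hlt : π y < π x := lt_of_le_of_ne (not_lt.1 hc) fun h => hx (π.injective h ▸ hy)
      have : π i < π x := by
        rcases lt_trichotomy (π i) (π x) with h | h | h
        · exact h
        · exact absurd (π.injective h ▸ hi) hx
        · exact absurd (hI.2 y hy i hi x hlt h) hx
      exact hπ ⟨x, i, j, hxi, hij, hinv, this⟩
  have right : ∀ x ∉ I, i < x → ∀ y ∈ I, y < x ∧ π y < π x := by
    intro x hx hxi y hy
    have hjx : ∀ y ∈ I, y < x := by
      intro y hy
      rcases lt_trichotomy y x with h | h | h
      · exact h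
      · exact absurd (h ▸ hy) hx
      · exact absurd (hI.1 i hi y hy x hxi h) hx
    refine ⟨hjx y hy, ?_⟩
    by_contra hc
    have hlt : π x < π y := lt_of_le_of_ne (not_lt.1 hc) fun h => hx (π.injective h ▸ hy)
    have : π x < π j := by
      rcases lt_trichotomy (π x) (π j) with h | h | h
      · exact h
      · exact absurd (π.injective h ▸ hj) hx
      · exact absurd (hI.2 j hj y hy x h hlt) hx
    exact hπ ⟨i, j, x, hij, hjx j hj, this, hinv⟩
  obtain ⟨p, hp⟩ := (Set.ne_univ_iff_exists_notMem I).1 hne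
  have tri : ∀ x, x ∉ I → x < i ∨ i < x := fun x hx =>
    lt_or_gt_of_ne fun h => hx (h ▸ hi)
  have cross : ∀ x ∉ I, x < i → ∀ y ∉ I, i < y → x < y ∧ π x < π y := fun x hx hxi y hy hiy =>
    ⟨hxi.trans hiy, (left x hx hxi i hi).2.trans (right y hy hiy i hi).2⟩
  rcases tri p hp with h | h
  · refine ⟨{x | x ∉ I ∧ x < i}, ⟨p, hp, h⟩, ⟨i, by simp⟩, ?_⟩
    rintro x ⟨hx, hxi⟩ y hy
    by_cases hyI : y ∈ I
    · exact left x hx hxi y hyI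
    · exact cross x hx hxi y hyI ((tri y hyI).resolve_left fun h => hy ⟨hyI, h⟩)
  · refine ⟨{x | x ∈ I ∨ x < i}, ⟨i, Or.inl hi⟩, ⟨p, ?_⟩, ?_⟩
    · simp [hp, h.le]
    rintro x hx y hy
    have hyI : y ∉ I := fun h => hy (Or.inl h)
    have hiy : i < y := (tri y hyI).resolve_left fun h => hy (Or.inr h)
    by_cases hxI : x ∈ I
    · exact right y hyI hiy x hxI
    · exact cross x hxI (hx.resolve_left hxI) y hyI hiy

/-- `π` increases on `I`. If `π x + 1` were skipped, it would be taken in `I`, at a place strictly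
between the adjacent places `x` and `y`. -/
theorem Avoids321.consecutive_of_isInterval (hπ : Avoids321 π) (hs : ¬ SumDec π)
    {I : Set (Fin n)} (hI : IsInterval π I) (hne : I ≠ Set.univ) {x y : Fin n} (hx : x ∈ I)
    (hy : y ∈ I) (hxy : (y : ℕ) = x + 1) : (π y : ℕ) = π x + 1 := by
  have inc : ∀ i ∈ I, ∀ j ∈ I, i < j → π i < π j := fun i hi j hj hij =>
    lt_of_le_of_ne (not_lt.1 fun h => hs (hπ.sumDec_of_inversion hI hne hi hj hij h))
      (π.injective.ne hij.ne)
  have hlt : π x < π y := inc x hx y hy (by rw [Fin.lt_def]; omega)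
  by_contra hc
  have hlt' := Fin.lt_def.1 hlt
  obtain ⟨z, hz⟩ := π.surjective ⟨π x + 1, by omega⟩
  have hz' := congrArg Fin.val hz
  simp only at hz'
  have hzI : z ∈ I := (isInterval_iff.1 hI).2 x hx y hy z (by rw [Fin.lt_def]; omega)
    (by rw [Fin.lt_def]; omega)
  rcases lt_trichotomy z x with h | h | h
  · have := Fin.lt_def.1 (inc z hzI x hx h)
    omega
  · subst h
    omega
  · rcases lt_trichotomy z y with h' | h' | h'
    · rw [Fin.lt_def] at h h'
      omega
    · subst h'
      omega
    · have := Fin.lt_def.1 (inc y hy z hzI h')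
      omega

theorem sumDec_of_fixed (hinv : Function.Involutive π) (hπ : Avoids321 π) (hn : 2 ≤ n)
    {i : Fin n} (hi : π i = i) : SumDec π := by
  have low : ∀ x, x < i → π x < i := by
    intro x hx
    rcases lt_trichotomy (π x) i with h | h | h
    · exact h
    · rw [← hinv x, h, hi] at hx
      exact absurd hx (lt_irrefl _)
    · exact absurd ⟨x, i, π x, hx, h, by rwa [hinv, hi], by rwa [hi]⟩ hπ
  have high : ∀ x, i < x → i < π x := by
    intro x hx
    rcases lt_trichotomy (π x) i with h | h | h
    · have := low _ h
      rw [hinv] at this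
      exact absurd this hx.not_gt
    · rw [← hinv x, h, hi] at hx
      exact absurd hx (lt_irrefl _)
    · exact h
  by_cases h : ∃ x, x < i
  · refine ⟨{x | x < i}, h, ⟨i, by simp⟩, fun x hx y hy => ?_⟩
    replace hy : i ≤ y := not_lt.1 hy
    refine ⟨lt_of_lt_of_le hx hy, ?_⟩
    rcases hy.eq_or_lt with rfl | hy'
    · exact (low x hx).trans_eq hi.symm
    · exact (low x hx).trans (high y hy')
  -- If no place precedes `i`, the summand split off is `i` itself.
  · have h0 : ∀ x, i ≤ x := fun x => not_lt.1 fun hx => h ⟨x, hx⟩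
    refine ⟨{i}, ⟨i, rfl⟩, ?_, ?_⟩
    · have : Nontrivial (Fin n) := Fin.nontrivial_iff_two_le.2 hn
      obtain ⟨y, hy⟩ := exists_ne i
      exact ⟨y, hy⟩
    · rintro x rfl y hy
      have hlt : x < y := lt_of_le_of_ne (h0 y) (Ne.symm hy)
      exact ⟨hlt, by rw [hi]; exact high y hlt⟩

theorem exists_monotone_surjective_quotient (g : Fin n → ℕ) (hg : Monotone g) :
    ∃ (m : ℕ) (f : Fin n → Fin m), Monotone f ∧ Function.Surjective f ∧
      ∀ x y, f x = f y ↔ g x = g y := by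
  let e := (Finset.univ.image g).orderIsoOfFin rfl
  let f : Fin n → Fin (Finset.univ.image g).card := fun x => e.symm ⟨g x, by simp⟩
  refine ⟨_, f, fun x y hxy => ?_, fun i => ?_, fun x y => ?_⟩
  · exact e.symm.monotone (hg hxy)
  · obtain ⟨v, hv⟩ := e i
    obtain ⟨x, -, hx⟩ := Finset.mem_image.1 (e i).2
    exact ⟨x, by simp [f, hx]⟩
  · simp [f]

/-- `π` is extended by the identity to all natural numbers. -/
def natFun (π : Equiv.Perm (Fin n)) (i : ℕ) : ℕ := if h : i < n then π ⟨i, h⟩ else i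

theorem natFun_val (x : Fin n) : natFun π x = π x := by simp [natFun]

theorem natFun_natFun (hinv : Function.Involutive π) (i : ℕ) :
    natFun π (natFun π i) = i := by
  by_cases h : i < n
  · have h1 : natFun π i = π ⟨i, h⟩ := natFun_val ⟨i, h⟩
    rw [h1, natFun_val, hinv]
  · simp [natFun, h]

open Finset in
/-- The number of places up to `i` at which a new maximal run of consecutive values starts. -/
def breaks (π : Equiv.Perm (Fin n)) (i : ℕ) : ℕ :=
  #{z ∈ range (i + 1) | 0 < z ∧ natFun π z ≠ natFun π (z - 1) + 1}

theorem breaks_mono : Monotone (breaks π) := fun i j h =>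
  Finset.card_le_card (Finset.filter_subset_filter _ (Finset.range_mono (by omega)))

/-- The breaks up to `i` are among those up to `j`, so equal counts mean that none lies in between.
-/
theorem breaks_eq_iff {i j : ℕ} (h : i ≤ j) :
    breaks π i = breaks π j ↔ ∀ z, i < z → z ≤ j → natFun π z = natFun π (z - 1) + 1 := by
  have hsub : (Finset.range (i + 1)).filter
      (fun z => 0 < z ∧ natFun π z ≠ natFun π (z - 1) + 1) ⊆ (Finset.range (j + 1)).filter
      (fun z => 0 < z ∧ natFun π z ≠ natFun π (z - 1) + 1) :=
    Finset.filter_subset_filter _ (Finset.range_mono (by omega))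
  constructor
  · intro he z h1 h2
    by_contra hc
    have heq := Finset.eq_of_subset_of_card_le hsub he.ge
    have hz : z ∈ (Finset.range (j + 1)).filter
      (fun z => 0 < z ∧ natFun π z ≠ natFun π (z - 1) + 1) := by
      simp only [Finset.mem_filter, Finset.mem_range]
      exact ⟨by omega, by omega, hc⟩
    rw [← heq] at hz
    simp only [Finset.mem_filter, Finset.mem_range] at hz
    omega
  · intro he
    refine congrArg Finset.card (Finset.Subset.antisymm hsub fun z hz => ?_)
    simp only [Finset.mem_filter, Finset.mem_range] at hz ⊢
    refine ⟨?_, hz.2⟩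
    by_contra hc
    exact hz.2.2 (he z (by omega) (by omega))

theorem natFun_add_of_breaks_eq {i j : ℕ} (h : i ≤ j) (he : breaks π i = breaks π j) :
    ∀ t, i + t ≤ j → natFun π (i + t) = natFun π i + t := by
  intro t
  induction t with
  | zero => simp
  | succ t ih =>
    intro ht
    have h1 := (breaks_eq_iff h).1 he (i + (t + 1)) (by omega) ht
    rw [h1, show i + (t + 1) - 1 = i + t by omega, ih (by omega)]
    omega

/-- A run maps onto consecutive places, and there `π`, being its own inverse, again has consecutive
values. So `π` permutes the runs and induces an involution on them. -/
theorem breaks_natFun_eq_of_le (hinv : Function.Involutive π) {i j : ℕ} (h : i ≤ j)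
    (he : breaks π i = breaks π j) : breaks π (natFun π i) = breaks π (natFun π j) := by
  have hrun := natFun_add_of_breaks_eq h he
  have hj := hrun (j - i) (by omega)
  rw [show i + (j - i) = j by omega] at hj
  rw [breaks_eq_iff (by omega)]
  intro z h1 h2
  have ha := hrun (z - natFun π i) (by omega)
  have hb := hrun (z - 1 - natFun π i) (by omega)
  rw [show natFun π i + (z - natFun π i) = z by omega] at ha
  rw [show natFun π i + (z - 1 - natFun π i) = z - 1 by omega] at hb
  have ha' := natFun_natFun hinv (i + (z - natFun π i))
  have hb' := natFun_natFun hinv (i + (z - 1 - natFun π i))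
  rw [ha] at ha'
  rw [hb] at hb'
  omega

theorem breaks_natFun_eq (hinv : Function.Involutive π) {i j : ℕ}
    (he : breaks π i = breaks π j) : breaks π (natFun π i) = breaks π (natFun π j) := by
  rcases le_total i j with h | h
  · exact breaks_natFun_eq_of_le hinv h he
  · exact (breaks_natFun_eq_of_le hinv h he.symm).symm

/-- The simple permutation of which `π` is an inflation arises by contracting the maximal runs. -/
theorem exists_simple_blockMap (hinv : Function.Involutive π) (hπ : Avoids321 π) (hn : 2 ≤ n)
    (hs : ¬ SumDec π) (hk : ¬ SkewDec π) :
    ∃ (m : ℕ) (σ : Equiv.Perm (Fin m)) (f : Fin n → Fin m), 2 < m ∧ IsSimple σ ∧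
      Function.Involutive σ ∧ IsBlockMap π σ f := by
  obtain ⟨m, f, hmono, hsurj, hf⟩ := exists_monotone_surjective_quotient
    (fun x : Fin n => breaks π x) fun x y h => breaks_mono h
  have hfπ : ∀ x y, f x = f y → f (π x) = f (π y) := by
    intro x y h
    rw [hf] at h ⊢
    rw [← natFun_val, ← natFun_val]
    exact breaks_natFun_eq hinv h
  let s := Function.surjInv hsurj
  have hs' : ∀ i, f (s i) = i := Function.surjInv_eq hsurj
  let σ₀ : Fin m → Fin m := fun i => f (π (s i))
  have hσ₀ : ∀ x, σ₀ (f x) = f (π x) := fun x => hfπ _ _ (hs' (f x))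
  have hσinv : Function.Involutive σ₀ := by
    intro i
    obtain ⟨x, rfl⟩ := hsurj i
    rw [hσ₀ x, hσ₀, hinv]
  let σ := hσinv.toPerm
  have hσ : ∀ x, σ (f x) = f (π x) := hσ₀
  have hblock : IsBlockMap π σ f := by
    refine ⟨hmono, hsurj, fun x y h => ?_⟩
    rw [hσ, hσ] at h
    exact lt_of_not_ge fun hc => (hmono hc).not_gt h
  refine ⟨m, σ, f, ?_, ?_, hσinv, hblock⟩
  -- One run would make `π` the identity, which has a fixed point; two runs would make it sum or
  -- skew decomposable.
  · by_contra hm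
    have hx : (0 : ℕ) < n := by omega
    have : m = 0 ∨ m = 1 ∨ m = 2 := by omega
    rcases this with rfl | rfl | rfl
    · exact (f ⟨0, hx⟩).elim0
    · have he : f ⟨0, hx⟩ = f ⟨n - 1, by omega⟩ := Subsingleton.elim _ _
      rw [hf] at he
      have h1 := natFun_add_of_breaks_eq (Nat.zero_le _) he (n - 1) (by simp)
      have h2 : natFun π (0 + (n - 1)) < n := by
        rw [zero_add]
        exact (natFun_val (π := π) ⟨n - 1, by omega⟩).trans_lt (π _).2
      have h3 : natFun π 0 = 0 := by omega
      rw [natFun_val (π := π) ⟨0, hx⟩] at h3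
      exact hs (sumDec_of_fixed hinv hπ hn (i := ⟨0, hx⟩) (Fin.ext h3))
    · rcases hblock.sumDec_or_skewDec with h | h
      · exact hs h.2
      · exact hk h.2
  -- The preimage of an interval is an interval of `π`; when proper it lies in one run, which is one
  -- point of the quotient.
  · intro J hJ
    have hI : IsInterval π (f ⁻¹' J) := by
      refine ⟨⟨fun x hx z hz y hy => hJ.1.out hx hz ⟨hmono hy.1, hmono hy.2⟩⟩, ⟨?_⟩⟩
      rintro _ ⟨x, hx, rfl⟩ _ ⟨z, hz, rfl⟩ v hv
      obtain ⟨y, rfl⟩ := π.surjective v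
      refine ⟨y, ?_, rfl⟩
      have hmid : σ (f y) ∈ Set.Icc (σ (f x)) (σ (f z)) := by
        rw [hσ, hσ, hσ]
        exact ⟨hmono hv.1, hmono hv.2⟩
      have := hJ.2.out (Set.mem_image_of_mem σ hx) (Set.mem_image_of_mem σ hz) hmid
      exact σ.injective.mem_set_image.1 this
    by_cases hne : f ⁻¹' J = Set.univ
    · refine Or.inr (Set.eq_univ_of_forall fun i => ?_)
      obtain ⟨x, rfl⟩ := hsurj i
      exact (hne ▸ Set.mem_univ x : x ∈ f ⁻¹' J)
    · left
      have key : ∀ x y : Fin n, x ≤ y → f x ∈ J → f y ∈ J → f x = f y := by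
        intro x y hxy hx hy
        rw [hf, breaks_eq_iff hxy]
        intro z h1 h2
        have hz : z < n := h2.trans_lt y.2
        have e1 : natFun π z = π ⟨z, hz⟩ := natFun_val (π := π) ⟨z, hz⟩
        have e2 : natFun π (z - 1) = π ⟨z - 1, by omega⟩ :=
          natFun_val (π := π) ⟨z - 1, by omega⟩
        rw [e1, e2]
        have hmem : ∀ w : Fin n, x ≤ w → w ≤ y → w ∈ f ⁻¹' J := fun w h1 h2 =>
          hI.1.out hx hy ⟨h1, h2⟩
        refine hπ.consecutive_of_isInterval hs hI hne (hmem _ ?_ ?_) (hmem _ ?_ ?_) ?_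
        · rw [Fin.le_def]; simp only; omega
        · rw [Fin.le_def]; simp only; omega
        · rw [Fin.le_def]; simp only; omega
        · rw [Fin.le_def]; simp only; omega
        · simp only; omega
      intro i hi j hj
      obtain ⟨x, rfl⟩ := hsurj i
      obtain ⟨y, rfl⟩ := hsurj j
      rcases le_total x y with h | h
      · exact key x y h hi hj
      · exact (key y x h hj hi).symm

end Runs

/-- The involutions avoiding 321 that have no fixed point. -/
def fixedPointFree (n : ℕ) : Set (Equiv.Perm (Fin n)) :=
  {π | π ∈ I321 n ∧ ∀ x, π x ≠ x}

/-- The non-empty sum indecomposable elements of a set of permutations. -/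
def indec (S : ∀ n : ℕ, Set (Equiv.Perm (Fin n))) (n : ℕ) : Set (Equiv.Perm (Fin n)) :=
  {π | π ∈ S n ∧ 0 < n ∧ ¬ SumDec π}

/-- The places at which the value exceeds the place. -/
def excedances {n : ℕ} (π : Equiv.Perm (Fin n)) : Finset (Fin n) := {x | x < π x}

/-! ### Excedances and the skew decomposable elements -/

section Excedances

variable {n : ℕ} {π : Equiv.Perm (Fin n)}

theorem mem_excedances {x : Fin n} : x ∈ excedances π ↔ x < π x := by simp [excedances]

/-- If `i < j` were excedances with `π j < π i`, the places `i < j < π j` would carry `π i > π j >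
j`. -/
theorem strictMonoOn_excedances (h : π ∈ I321 n) : StrictMonoOn π (excedances π) := by
  intro i hi j hj hij
  rw [SetLike.mem_coe, mem_excedances] at hi hj
  by_contra hc
  have hlt : π j < π i := lt_of_le_of_ne (not_lt.1 hc) (π.injective.ne hij.ne')
  exact h.2 ⟨i, j, π j, hij, hj, by rwa [h.1], hlt⟩

theorem apply_mem_excedances (h : π ∈ fixedPointFree n) (x : Fin n) :
    π x ∈ excedances π ↔ x ∉ excedances π := by
  rw [mem_excedances, mem_excedances, h.1.1, not_lt]
  exact ⟨le_of_lt, fun hle => lt_of_le_of_ne hle (h.2 x)⟩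

theorem image_excedances (h : π ∈ fixedPointFree n) :
    π '' (excedances π) = ((excedances π : Set (Fin n)))ᶜ := by
  ext y
  rw [Set.mem_compl_iff, SetLike.mem_coe]
  constructor
  · rintro ⟨x, hx, rfl⟩
    rw [apply_mem_excedances h, not_not]
    exact hx
  · intro hy
    exact ⟨π y, (apply_mem_excedances h y).2 hy, h.1.1 y⟩

theorem card_compl_excedances (h : π ∈ fixedPointFree n) :
    (excedances π)ᶜ.card = (excedances π).card := by
  have := congrArg Set.ncard (image_excedances h)
  rw [Set.ncard_image_of_injective _ π.injective, ← Finset.coe_compl, Set.ncard_coe_finset,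
    Set.ncard_coe_finset] at this
  exact this.symm

theorem two_mul_card_excedances (h : π ∈ fixedPointFree n) :
    2 * (excedances π).card = n := by
  have h1 := (excedances π).card_add_card_compl
  rw [card_compl_excedances h, Fintype.card_fin] at h1
  omega

/-- On its excedances `π` is the only increasing bijection onto the complement; on the complement it
is the inverse. -/
theorem excedances_injOn : Set.InjOn excedances (fixedPointFree n) := by
  intro π h π' h' he
  have hr := ((strictMonoOn_excedances h.1).strictMono).range_inj
    (g := fun x : (excedances π : Set (Fin n)) => π' x)
    (fun x y hxy => strictMonoOn_excedances h'.1 (he ▸ x.2) (he ▸ y.2) hxy)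
  have hc : (fun x : (excedances π : Set (Fin n)) => π' x) = π' ∘ Subtype.val := rfl
  rw [hc, Set.range_comp, Set.range_comp, Subtype.range_coe, image_excedances h, he,
    image_excedances h'] at hr
  have e2 : ∀ x ∈ excedances π, π x = π' x := fun x hx =>
    congrFun (hr.1 rfl) ⟨x, he ▸ hx⟩
  ext1 x
  by_cases hx : x ∈ excedances π
  · exact e2 x hx
  · have := e2 (π x) ((apply_mem_excedances h x).2 hx)
    rw [h.1.1] at this
    exact π'.injective (by rw [← this, h'.1.1])

theorem mem_iff_lt_card {L : Finset (Fin n)} (h : ∀ x ∈ L, ∀ y ∉ L, x < y) (x : Fin n) :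
    x ∈ L ↔ (x : ℕ) < L.card := by
  constructor
  · intro hx
    have : Finset.Iic x ⊆ L := fun y hy => by
      by_contra hc
      exact (Finset.mem_Iic.1 hy).not_gt (h x hx y hc)
    have := Finset.card_le_card this
    rw [Fin.card_Iic] at this
    omega
  · intro hx
    by_contra hc
    have : L ⊆ Finset.Iio x := fun y hy => Finset.mem_Iio.2 (h y hy x hc)
    have := Finset.card_le_card this
    rw [Fin.card_Iio] at this
    omega

/-- Each part is increasing, since an inversion in it and a place of the other part would form a
321. This forces `π` to exchange `L` and `Lᶜ`, so `L` is the set of excedances and the first half of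
the places. -/
theorem SkewDec.excedances (h : π ∈ I321 n) (hs : SkewDec π) :
    π ∈ fixedPointFree n ∧ ∀ x, x ∈ excedances π ↔ 2 * (x : ℕ) < n := by
  obtain ⟨L, ⟨x₀, hx₀⟩, ⟨y₀, hy₀⟩, hL⟩ := hs
  have incL : ∀ i ∈ L, ∀ j ∈ L, i < j → π i < π j := by
    intro i hi j hj hij
    by_contra hc
    exact h.2 ⟨i, j, y₀, hij, (hL j hj y₀ hy₀).1, (hL j hj y₀ hy₀).2,
      lt_of_le_of_ne (not_lt.1 hc) (π.injective.ne hij.ne')⟩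
  have incL' : ∀ i ∉ L, ∀ j ∉ L, i < j → π i < π j := by
    intro i hi j hj hij
    by_contra hc
    exact h.2 ⟨x₀, i, j, (hL x₀ hx₀ i hi).1, hij,
      lt_of_le_of_ne (not_lt.1 hc) (π.injective.ne hij.ne'), (hL x₀ hx₀ i hi).2⟩
  have lower : ∀ x ∈ L, ∀ y, y < x → y ∈ L := fun x hx y hy => by
    by_contra hc
    exact hy.not_gt (hL x hx y hc).1
  have up : ∀ x ∈ L, π x ∉ L := by
    intro x hx hc
    have h1 : π y₀ ∈ L := lower _ hc _ (hL x hx y₀ hy₀).2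
    have h2 : π y₀ < x := by
      have := (hL _ hc y₀ hy₀).2
      rwa [h.1] at this
    have h3 := incL _ h1 _ hx h2
    rw [h.1] at h3
    exact h3.not_gt (hL _ hc y₀ hy₀).1
  have down : ∀ y ∉ L, π y ∈ L := by
    intro y hy
    by_contra hc
    have h3 := incL' _ hc _ (up x₀ hx₀) (hL x₀ hx₀ y hy).2
    rw [h.1, h.1] at h3
    exact h3.not_gt (hL x₀ hx₀ y hy).1
  have hexc : ∀ x, x ∈ Inv321.excedances π ↔ x ∈ L := by
    intro x
    rw [mem_excedances]
    constructor
    · intro hx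
      by_contra hc
      exact hx.not_gt (hL _ (down x hc) x hc).1
    · intro hx
      exact (hL x hx _ (up x hx)).1
  have hfree : π ∈ fixedPointFree n := by
    refine ⟨h, fun x hx => ?_⟩
    by_cases hxL : x ∈ L
    · exact up x hxL (hx.symm ▸ hxL)
    · exact hxL (hx ▸ down x hxL)
  refine ⟨hfree, fun x => ?_⟩
  rw [mem_iff_lt_card (fun x hx y hy => (hL x ((hexc x).1 hx) y fun h => hy ((hexc y).2 h)).1)]
  have := two_mul_card_excedances hfree
  omega

theorem SkewDec.not_sumDec (h : SkewDec π) : ¬ SumDec π := by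
  rintro ⟨M, ⟨x, hx⟩, ⟨y, hy⟩, hM⟩
  obtain ⟨L, ⟨a, ha⟩, ⟨b, hb⟩, hL⟩ := h
  by_cases hbM : b ∈ M
  · have haM : a ∈ M := by
      by_contra hc
      exact (hL a ha b hb).1.not_gt (hM b hbM a hc).1
    by_cases hyL : y ∈ L
    · exact (hL y hyL b hb).1.not_gt (hM b hbM y hy).1
    · exact (hL a ha y hyL).2.not_gt (hM a haM y hy).2
  · by_cases hxL : x ∈ L
    · exact (hL x hxL b hb).2.not_gt (hM x hx b hbM).2
    · have haM : a ∈ M := by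
        by_contra hc
        exact (hL a ha x hxL).1.not_gt (hM x hx a hc).1
      exact (hL a ha b hb).2.not_gt (hM a haM b hbM).2

/-- The skew decomposable elements of `I(321)`. -/
def skewDecomposable (n : ℕ) : Set (Equiv.Perm (Fin n)) := {π | π ∈ I321 n ∧ SkewDec π}

theorem skewDecomposable_subsingleton : (skewDecomposable n).Subsingleton := by
  intro π h π' h'
  obtain ⟨h1, h2⟩ := SkewDec.excedances h.1 h.2
  obtain ⟨h1', h2'⟩ := SkewDec.excedances h'.1 h'.2
  exact excedances_injOn h1 h1' (Finset.ext fun x => (h2 x).trans (h2' x).symm)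

theorem skewDecomposable_nonempty {p : ℕ} (hp : 0 < p) :
    (skewDecomposable (2 * p)).Nonempty := by
  -- The two halves are exchanged by a shift by `p`.
  let g : Fin (2 * p) → Fin (2 * p) := fun x =>
    if h : (x : ℕ) < p then ⟨x + p, by omega⟩ else ⟨x - p, by omega⟩
  have g1 : ∀ x : Fin (2 * p), (x : ℕ) < p → (g x : ℕ) = x + p := fun x h => by simp [g, h]
  have g2 : ∀ x : Fin (2 * p), ¬ (x : ℕ) < p → (g x : ℕ) = x - p := fun x h => by simp [g, h]
  have hg : Function.Involutive g := by
    intro x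
    ext
    by_cases h : (x : ℕ) < p
    · have := g1 x h
      rw [g2 (g x) (by omega)]
      omega
    · have := g2 x h
      rw [g1 (g x) (by omega)]
      omega
  refine ⟨hg.toPerm, ⟨hg, ?_⟩, {x | (x : ℕ) < p}, ⟨⟨0, by omega⟩, hp⟩, ⟨⟨p, by omega⟩, ?_⟩, ?_⟩
  · rintro ⟨i, j, k, h1, h2, h3, h4⟩
    simp only [Function.Involutive.coe_toPerm, Fin.lt_def] at h1 h2 h3 h4
    have := g1 i
    have := g1 j
    have := g1 k
    have := g2 i
    have := g2 j
    have := g2 k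
    omega
  · simp
  · intro x hx y hy
    simp only [Set.mem_ofPred_eq] at hx hy
    have h1 := g1 x hx
    have h2 := g2 y hy
    simp only [Function.Involutive.coe_toPerm, Fin.lt_def]
    omega

theorem ncard_skewDecomposable (n : ℕ) :
    (skewDecomposable n).ncard = if 0 < n ∧ Even n then 1 else 0 := by
  split_ifs with h
  · obtain ⟨p, rfl⟩ := even_iff_exists_two_mul.1 h.2
    obtain ⟨π, hπ⟩ := skewDecomposable_nonempty (p := p) (by omega)
    exact Set.ncard_eq_one.2 ⟨π, skewDecomposable_subsingleton.eq_singleton_of_mem hπ⟩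
  · rw [Set.ncard_eq_zero]
    refine Set.eq_empty_of_forall_notMem fun π hπ => h ⟨?_, ?_⟩
    · obtain ⟨x, -⟩ := hπ.2.choose_spec.1
      exact x.pos
    · rw [← two_mul_card_excedances (SkewDec.excedances hπ.1 hπ.2).1]
      exact even_two_mul _

end Excedances

/-! ### Simple involutions and their inflations among the indecomposables -/

theorem mem_simpleInv_or_inflatedSimpleInv_iff {n : ℕ} {π : Equiv.Perm (Fin n)} :
    π ∈ simpleInv n ∪ inflatedSimpleInv n ↔ π ∈ indec fixedPointFree n \ skewDecomposable n := by
  constructor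
  · intro h
    have key : ∃ (m : ℕ) (σ : Equiv.Perm (Fin m)) (f : Fin n → Fin m), π ∈ I321 n ∧ 2 < m ∧
        IsSimple σ ∧ IsBlockMap π σ f := by
      rcases h with h | ⟨h, m, σ, h1, h2, h3, h4, h5⟩
      · exact ⟨n, π, id, h.1, h.2.1, h.2.2, isBlockMap_id π⟩
      · obtain ⟨f, hf⟩ := isInflationOf_iff.1 h5
        exact ⟨m, σ, f, h, h1, h3, hf⟩
    obtain ⟨m, σ, f, hπ, hm, hσ, hf⟩ := key
    have hs := hf.not_sumDec hσ hm
    have hn := hf.le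
    exact ⟨⟨⟨hπ, fun x hx => hs (sumDec_of_fixed hπ.1 hπ.2 (by omega) hx)⟩, by omega, hs⟩,
      fun hk => hf.not_skewDec hσ hm hk.2⟩
  · rintro ⟨⟨hfree, hpos, hs⟩, hk⟩
    have hπ := hfree.1
    have hn : 2 ≤ n := by
      have := two_mul_card_excedances hfree
      omega
    obtain ⟨m, σ, f, hm, hσ, hinv, hf⟩ :=
      exists_simple_blockMap hπ.1 hπ.2 hn hs fun h => hk ⟨hπ, h⟩
    rcases hf.le.eq_or_lt with h | h
    · exact Or.inl ⟨hπ, by omega, hf.isSimple_of_eq hσ h⟩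
    · exact Or.inr ⟨hπ, m, σ, hm, h, hσ, hinv, hf.isInflationOf⟩

theorem ncard_simpleInv_add (n : ℕ) :
    (simpleInv n).ncard + (inflatedSimpleInv n).ncard + (skewDecomposable n).ncard =
      (indec fixedPointFree n).ncard := by
  have hdisj : Disjoint (simpleInv n) (inflatedSimpleInv n) := by
    rw [Set.disjoint_left]
    rintro π h ⟨-, m, σ, h1, h2, -, -, h5⟩
    obtain ⟨f, hf⟩ := isInflationOf_iff.1 h5
    exact hf.not_isSimple h1 h2 h.2.2
  have hsub : skewDecomposable n ⊆ indec fixedPointFree n := fun π hπ =>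
    ⟨(SkewDec.excedances hπ.1 hπ.2).1, hπ.2.choose_spec.1.choose.pos, hπ.2.not_sumDec⟩
  rw [← Set.ncard_union_eq hdisj (Set.toFinite _) (Set.toFinite _),
    ← Set.ncard_sdiff_add_ncard_of_subset hsub (Set.toFinite _)]
  congr 2
  ext π
  exact mem_simpleInv_or_inflatedSimpleInv_iff

/-- The direct sum of two permutations. -/
def directSum {k l : ℕ} (a : Equiv.Perm (Fin k)) (b : Equiv.Perm (Fin l)) :
    Equiv.Perm (Fin (k + l)) :=
  finSumFinEquiv.permCongr (Equiv.Perm.sumCongr a b)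

/-! ### Unique splitting of the first indecomposable summand -/

section DirectSum

variable {k l : ℕ} (a : Equiv.Perm (Fin k)) (b : Equiv.Perm (Fin l))

@[simp] theorem directSum_castAdd (i : Fin k) :
    directSum a b (Fin.castAdd l i) = Fin.castAdd l (a i) := by
  simp [directSum, Equiv.permCongr_apply]

@[simp] theorem directSum_natAdd (i : Fin l) :
    directSum a b (Fin.natAdd k i) = Fin.natAdd k (b i) := by
  simp [directSum, Equiv.permCongr_apply]

theorem directSum_injective : Function.Injective
    fun p : Equiv.Perm (Fin k) × Equiv.Perm (Fin l) => directSum p.1 p.2 := by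
  rintro ⟨a, b⟩ ⟨a', b'⟩ h
  simp only at h
  refine Prod.ext (Equiv.ext fun i => ?_) (Equiv.ext fun i => ?_)
  · have := congrArg (fun π => π (Fin.castAdd l i)) h
    simpa using this
  · have := congrArg (fun π => π (Fin.natAdd k i)) h
    simpa using this

/-- The first `k` places carry the first `k` values. -/
def Splits {n : ℕ} (π : Equiv.Perm (Fin n)) (k : ℕ) : Prop :=
  ∀ x : Fin n, (x : ℕ) < k → (π x : ℕ) < k

theorem Splits.exists_directSum {π : Equiv.Perm (Fin (k + l))} (h : Splits π k) :
    ∃ a b, π = directSum a b := by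
  have hmem : finSumFinEquiv.symm.permCongr π ∈ (Equiv.Perm.sumCongrHom (Fin k) (Fin l)).range := by
    refine Equiv.Perm.mem_sumCongrHom_range_of_perm_mapsTo_inl ?_
    rintro _ ⟨i, rfl⟩
    have := h (Fin.castAdd l i) (by simp)
    refine ⟨⟨_, this⟩, ?_⟩
    rw [Equiv.permCongr_apply, Equiv.symm_symm, Equiv.eq_symm_apply]
    ext
    simp
  obtain ⟨⟨a, b⟩, hab⟩ := hmem
  refine ⟨a, b, ?_⟩
  rw [directSum, show Equiv.Perm.sumCongr a b = _ from hab]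
  ext x
  simp [Equiv.permCongr_apply]

theorem splits_directSum : Splits (directSum a b) k := by
  intro x hx
  induction x using Fin.addCases with
  | left i => simp
  | right i => simp at hx

theorem splits_directSum_iff {j : ℕ} (hj : j ≤ k) : Splits (directSum a b) j ↔ Splits a j := by
  constructor
  · intro h x hx
    simpa using h (Fin.castAdd l x) (by simpa using hx)
  · intro h x hx
    induction x using Fin.addCases with
    | left i => simpa using h i (by simpa using hx)
    | right i => simp at hx; omega

/-- `L` and its image are initial segments of equal cardinality, so the cut is given by a number. -/
theorem sumDec_iff {n : ℕ} {π : Equiv.Perm (Fin n)} :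
    SumDec π ↔ ∃ k, 0 < k ∧ k < n ∧ Splits π k := by
  classical
  constructor
  · rintro ⟨L, ⟨x₀, hx₀⟩, ⟨y₀, hy₀⟩, hL⟩
    have mem := mem_iff_lt_card (L := L.toFinset) fun x hx y hy =>
      (hL x (by simpa using hx) y (by simpa using hy)).1
    have mem' := mem_iff_lt_card (L := L.toFinset.map π.toEmbedding) fun x hx y hy => by
      obtain ⟨z, rfl⟩ := π.surjective x
      obtain ⟨w, rfl⟩ := π.surjective y
      exact (hL z (by simpa using hx) w (by simpa using hy)).2
    refine ⟨L.toFinset.card, ?_, ?_, fun x hx => ?_⟩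
    · exact Finset.card_pos.2 ⟨x₀, by simpa using hx₀⟩
    · have := (mem y₀).not.1 (by simpa using hy₀)
      omega
    · have := (mem' (π x)).1 (by simpa using (mem x).2 hx)
      simpa using this
  · rintro ⟨k, h0, hn, h⟩
    obtain ⟨l, rfl⟩ := Nat.exists_eq_add_of_le hn.le
    obtain ⟨a, b, rfl⟩ := Splits.exists_directSum h
    refine ⟨{x | (x : ℕ) < k}, ⟨⟨0, by omega⟩, h0⟩, ⟨⟨k, by omega⟩, by simp⟩, ?_⟩
    intro x hx y hy
    rw [Set.mem_ofPred_eq] at hx hy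
    refine ⟨by rw [Fin.lt_def]; omega, ?_⟩
    have h1 := splits_directSum a b x hx
    induction y using Fin.addCases with
    | left i => simp at hy
    | right i =>
      rw [directSum_natAdd, Fin.lt_def, Fin.val_natAdd]
      omega

/-- The least size of an initial segment of places that carries the least values. -/
noncomputable def firstSplit {n : ℕ} (π : Equiv.Perm (Fin n)) : ℕ := sInf {k | 0 < k ∧ Splits π k}

theorem firstSplit_mem {n : ℕ} (hn : 0 < n) (π : Equiv.Perm (Fin n)) :
    0 < firstSplit π ∧ Splits π (firstSplit π) :=
  Nat.sInf_mem (s := {k | 0 < k ∧ Splits π k}) ⟨n, hn, fun x _ => (π x).2⟩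

theorem firstSplit_le {n k : ℕ} {π : Equiv.Perm (Fin n)} (hk : 0 < k) (h : Splits π k) :
    firstSplit π ≤ k := Nat.sInf_le ⟨hk, h⟩

/-- A set of permutations that contains the empty one, and a direct sum iff it contains
both summands. -/
structure SumClosed (S : ∀ n : ℕ, Set (Equiv.Perm (Fin n))) : Prop where
  zero : S 0 = Set.univ
  directSum_mem {k l : ℕ} (a : Equiv.Perm (Fin k)) (b : Equiv.Perm (Fin l)) :
    directSum a b ∈ S (k + l) ↔ a ∈ S k ∧ b ∈ S l

variable {S : ∀ n : ℕ, Set (Equiv.Perm (Fin n))}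

/-- Minimality of the split is indecomposability of the first summand. For `k = 0` both sides
vanish. -/
theorem SumClosed.ncard_firstSplit_eq (hS : SumClosed S) (h : 0 < k + l) :
    {π | π ∈ S (k + l) ∧ firstSplit π = k}.ncard = (indec S k).ncard * (S l).ncard := by
  rw [← Set.ncard_prod, ← Set.ncard_image_of_injective _ directSum_injective]
  congr 1
  ext π
  constructor
  · rintro ⟨hπ, hk⟩
    have hmem := firstSplit_mem h π
    rw [hk] at hmem
    obtain ⟨a, b, rfl⟩ := hmem.2.exists_directSum
    have hab := (hS.directSum_mem a b).1 hπ
    refine ⟨(a, b), ⟨⟨hab.1, hmem.1, fun hs => ?_⟩, hab.2⟩, rfl⟩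
    obtain ⟨j, h0, hj, hs⟩ := sumDec_iff.1 hs
    have := firstSplit_le h0 ((splits_directSum_iff a b hj.le).2 hs)
    omega
  · rintro ⟨⟨a, b⟩, ⟨⟨ha, hk, hs⟩, hb⟩, rfl⟩
    refine ⟨(hS.directSum_mem a b).2 ⟨ha, hb⟩, ?_⟩
    have hle := firstSplit_le hk (splits_directSum a b)
    have hmem := firstSplit_mem h (directSum a b)
    refine le_antisymm hle (not_lt.1 fun hlt => hs ?_)
    exact sumDec_iff.2 ⟨_, hmem.1, hlt, (splits_directSum_iff a b hle).1 hmem.2⟩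

theorem SumClosed.ncard_eq_sum (hS : SumClosed S) {n : ℕ} (hn : 0 < n) :
    (S n).ncard = ∑ p ∈ Finset.HasAntidiagonal.antidiagonal n, (indec S p.1).ncard * (S p.2).ncard := by
  classical
  rw [Set.ncard_eq_toFinset_card', Finset.card_eq_sum_card_fiberwise (f := firstSplit)
    (t := Finset.range (n + 1)), Finset.Nat.sum_antidiagonal_eq_sum_range_succ_mk]
  · refine Finset.sum_congr rfl fun k hk => ?_
    obtain ⟨l, rfl⟩ := Nat.exists_eq_add_of_le (Nat.lt_succ_iff.1 (Finset.mem_range.1 hk))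
    rw [Nat.add_sub_cancel_left, ← hS.ncard_firstSplit_eq hn, Set.ncard_eq_toFinset_card']
    congr 1
    ext π
    simp
  · intro π _
    have := firstSplit_le hn (π := π) fun x _ => (π x).2
    simpa using Nat.lt_succ_iff.2 this

theorem indec_zero : indec S 0 = ∅ :=
  Set.eq_empty_of_forall_notMem fun _ h => lt_irrefl _ h.2.1

theorem SumClosed.genFun_eq (hS : SumClosed S) :
    genFun S = 1 + genFun (indec S) * genFun S := by
  ext n
  rw [map_add, PowerSeries.coeff_mul]
  simp only [genFun, PowerSeries.coeff_mk]
  rcases Nat.eq_zero_or_pos n with rfl | hn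
  · simp [indec_zero, hS.zero, Set.ncard_univ]
  · rw [hS.ncard_eq_sum hn, PowerSeries.coeff_one, if_neg hn.ne']
    push_cast
    simp

end DirectSum

/-! ### The classes as sum closed sets -/

theorem castAdd_lt {k l : ℕ} (i j : Fin k) : Fin.castAdd l i < Fin.castAdd l j ↔ i < j := Iff.rfl

theorem natAdd_lt {k l : ℕ} (i j : Fin l) : Fin.natAdd k i < Fin.natAdd k j ↔ i < j := by
  rw [Fin.lt_def, Fin.lt_def, Fin.val_natAdd, Fin.val_natAdd]
  omega

/-- An inversion of a direct sum lies within one summand, hence so does a 321. -/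
theorem sumClosed_I321 : SumClosed I321 where
  zero := by
    refine Set.eq_univ_of_forall fun π => ⟨fun x => x.elim0, ?_⟩
    rintro ⟨i, -⟩
    exact i.elim0
  directSum_mem {k l} a b := by
    constructor
    · rintro ⟨h1, h2⟩
      refine ⟨⟨fun x => ?_, ?_⟩, ⟨fun x => ?_, ?_⟩⟩
      · simpa using h1 (Fin.castAdd l x)
      · rintro ⟨x, y, z, hx⟩
        exact h2 ⟨Fin.castAdd l x, Fin.castAdd l y, Fin.castAdd l z, by simpa [castAdd_lt, natAdd_lt] using hx⟩
      · simpa using h1 (Fin.natAdd k x)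
      · rintro ⟨x, y, z, hx⟩
        exact h2 ⟨Fin.natAdd k x, Fin.natAdd k y, Fin.natAdd k z, by simpa [castAdd_lt, natAdd_lt] using hx⟩
    · rintro ⟨⟨h1, h2⟩, ⟨h3, h4⟩⟩
      refine ⟨fun x => ?_, ?_⟩
      · induction x using Fin.addCases with
        | left i => simp [h1 i]
        | right i => simp [h3 i]
      · rintro ⟨x, y, z, hxy, hyz, hzy, hyx⟩
        induction x using Fin.addCases with
        | left x =>
          induction y using Fin.addCases with
          | left y =>
            induction z using Fin.addCases with
            | left z =>
              simp only [castAdd_lt, directSum_castAdd] at hxy hyz hzy hyx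
              exact h2 ⟨x, y, z, hxy, hyz, hzy, hyx⟩
            | right z => simp [Fin.lt_def] at hzy; omega
          | right y => simp [Fin.lt_def] at hyx; omega
        | right x =>
          induction y using Fin.addCases with
          | left y => simp [Fin.lt_def] at hxy; omega
          | right y =>
            induction z using Fin.addCases with
            | left z => simp [Fin.lt_def] at hyz; omega
            | right z =>
              simp only [natAdd_lt, directSum_natAdd] at hxy hyz hzy hyx
              exact h4 ⟨x, y, z, hxy, hyz, hzy, hyx⟩

theorem sumClosed_fixedPointFree : SumClosed fixedPointFree where
  zero := Set.eq_univ_of_forall fun π => ⟨sumClosed_I321.zero ▸ Set.mem_univ π, fun x => x.elim0⟩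
  directSum_mem {k l} a b := by
    have key : (∀ x, directSum a b x ≠ x) ↔ (∀ x, a x ≠ x) ∧ ∀ x, b x ≠ x := by
      constructor
      · intro h
        refine ⟨fun x => ?_, fun x => ?_⟩
        · simpa using h (Fin.castAdd l x)
        · simpa using h (Fin.natAdd k x)
      · rintro ⟨h1, h2⟩ x
        induction x using Fin.addCases with
        | left i => simpa using h1 i
        | right i => simpa using h2 i
    change directSum a b ∈ I321 _ ∧ _ ↔ (a ∈ I321 _ ∧ _) ∧ (b ∈ I321 _ ∧ _)
    rw [sumClosed_I321.directSum_mem, key]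
    tauto

theorem genFun_indec_I321 : genFun (indec I321) = X + genFun (indec fixedPointFree) := by
  ext n
  simp only [genFun, map_add, PowerSeries.coeff_mk, PowerSeries.coeff_X]
  by_cases hn : n = 1
  · subst hn
    have h1 : indec I321 1 = Set.univ := by
      refine Set.eq_univ_of_forall fun π => ⟨⟨fun x => Subsingleton.elim _ _, ?_⟩, one_pos, ?_⟩
      · rintro ⟨i, j, k, h, -⟩
        exact h.ne (Subsingleton.elim _ _)
      · rw [sumDec_iff]
        rintro ⟨k, h1, h2, -⟩
        omega
    have h2 : indec fixedPointFree 1 = ∅ :=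
      Set.eq_empty_of_forall_notMem fun π h => h.1.2 0 (Subsingleton.elim _ _)
    simp [h1, h2, Set.ncard_univ]
  · have : indec I321 n = indec fixedPointFree n := by
      ext π
      refine ⟨fun h => ⟨⟨h.1, fun x hx => h.2.2 ?_⟩, h.2⟩, fun h => ⟨h.1.1, h.2⟩⟩
      have := h.2.1
      exact sumDec_of_fixed h.1.1 h.1.2 (by omega) hx
    simp [hn, this]

theorem genFun_I321_eq : genFun I321 = 1 + genFun (indec I321) + alphaGF := by
  ext n
  simp only [alphaGF, genFun, map_add, PowerSeries.coeff_mk]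
  rcases Nat.eq_zero_or_pos n with rfl | hn
  · have : sumDecomposable 0 = ∅ := by
      refine Set.eq_empty_of_forall_notMem fun π h => ?_
      obtain ⟨k, h1, h2, -⟩ := sumDec_iff.1 (isInflationOf_one_iff.1 h.2)
      omega
    simp [indec_zero, this, sumClosed_I321.zero, Set.ncard_univ]
  · rw [PowerSeries.coeff_one, if_neg hn.ne', zero_add]
    have hdisj : Disjoint (indec I321 n) (sumDecomposable n) :=
      Set.disjoint_left.2 fun π h h' => h.2.2 (isInflationOf_one_iff.1 h'.2)
    have hunion : indec I321 n ∪ sumDecomposable n = I321 n := by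
      ext π
      constructor
      · rintro (h | h) <;> exact h.1
      · intro h
        by_cases hs : SumDec π
        · exact Or.inr ⟨h, isInflationOf_one_iff.2 hs⟩
        · exact Or.inl ⟨h, hn, hs⟩
    rw [← hunion, Set.ncard_union_eq hdisj (Set.toFinite _) (Set.toFinite _)]
    push_cast
    rfl

/-! ### Dyck words -/

open Finset in
theorem count_take_ofFn {α : Type*} [DecidableEq α] (a : α) :
    ∀ {n : ℕ} (f : Fin n → α) (i : ℕ),
      ((List.ofFn f).take i).count a = #{y : Fin n | (y : ℕ) < i ∧ f y = a}
  | 0, f, i => by simp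
  | n + 1, f, 0 => by simp
  | n + 1, f, i + 1 => by
    rw [List.ofFn_succ, List.take_succ_cons, List.count_cons, count_take_ofFn,
      Fin.card_filter_univ_succ]
    simp only [Fin.val_zero, Nat.succ_pos, true_and, Fin.val_succ, Nat.add_lt_add_iff_right,
      beq_iff_eq]
    split_ifs <;> simp [add_comm]

/-- The word with an up step at the places in `E` and a down step at the other places. -/
def stepWord {n : ℕ} (E : Finset (Fin n)) : List DyckStep :=
  List.ofFn fun i => if i ∈ E then DyckStep.U else DyckStep.D

section Dyck

variable {n : ℕ} {E : Finset (Fin n)}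

open Finset in
theorem count_U_take_stepWord (i : ℕ) :
    ((stepWord E).take i).count DyckStep.U = #(filter (fun y : Fin n => (y : ℕ) < i) E) := by
  rw [stepWord, count_take_ofFn]
  congr 1
  ext y
  by_cases h : y ∈ E <;> simp [h]

open Finset in
theorem count_D_take_stepWord (i : ℕ) :
    ((stepWord E).take i).count DyckStep.D = #(filter (fun y : Fin n => (y : ℕ) < i) Eᶜ) := by
  rw [stepWord, count_take_ofFn]
  congr 1
  ext y
  by_cases h : y ∈ E <;> simp [h]

theorem take_stepWord : (stepWord E).take n = stepWord E :=
  List.take_of_length_le (by simp [stepWord])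

theorem count_U_stepWord : (stepWord E).count DyckStep.U = E.card := by
  rw [← take_stepWord, count_U_take_stepWord]
  simp

theorem count_D_stepWord : (stepWord E).count DyckStep.D = Eᶜ.card := by
  rw [← take_stepWord, count_D_take_stepWord]
  simp

theorem stepWord_injective : Function.Injective (stepWord (n := n)) := by
  intro E E' h
  have := List.ofFn_injective h
  ext i
  have hi := congrFun this i
  by_cases h1 : i ∈ E <;> by_cases h2 : i ∈ E' <;> simp_all

open Finset in
-- `π` injects the non-excedances below `i` into the excedances, and lowers them.
theorem ballot_excedances {π : Equiv.Perm (Fin n)} (h : π ∈ fixedPointFree n) (i : ℕ) :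
    #(filter (fun y : Fin n => (y : ℕ) < i) (excedances π)ᶜ) ≤
      #(filter (fun y : Fin n => (y : ℕ) < i) (excedances π)) := by
  refine card_le_card_of_injOn π (fun y hy => ?_) π.injective.injOn
  simp only [coe_filter, mem_compl, Set.mem_ofPred_eq] at hy ⊢
  refine ⟨(apply_mem_excedances h y).2 hy.1, ?_⟩
  have := hy.1
  rw [mem_excedances, not_lt, Fin.le_def] at this
  omega

open Finset in
/-- The `j`-th element of `E` is exchanged with the `j`-th element of the complement. -/
theorem exists_excedances_eq (hcard : Eᶜ.card = E.card)
    (hb : ∀ i : ℕ, #(filter (fun y : Fin n => (y : ℕ) < i) Eᶜ) ≤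
      #(filter (fun y : Fin n => (y : ℕ) < i) E)) :
    ∃ π ∈ fixedPointFree n, excedances π = E := by
  let φ : E ≃o (Eᶜ : Finset (Fin n)) :=
    (E.orderIsoOfFin rfl).symm.trans (Eᶜ.orderIsoOfFin hcard)
  have notMem : ∀ x : E, (φ x : Fin n) ∉ E := fun x => mem_compl.1 (φ x).2
  let g : Fin n → Fin n := fun x =>
    if h : x ∈ E then φ ⟨x, h⟩ else φ.symm ⟨x, mem_compl.2 h⟩
  have g1 : ∀ x : E, g x = φ x := fun x => by simp [g]
  have g2 : ∀ x : (Eᶜ : Finset (Fin n)), g x = φ.symm x := fun x => by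
    simp [g, mem_compl.1 x.2]
  have hg : Function.Involutive g := by
    intro x
    by_cases h : x ∈ E
    · have := g1 ⟨x, h⟩
      simp only at this
      rw [this, g2, φ.symm_apply_apply]
    · have := g2 ⟨x, mem_compl.2 h⟩
      simp only at this
      rw [this, g1, φ.apply_symm_apply]
  have count : ∀ x : E, #{y ∈ E | y ≤ (x : Fin n)} = #{y ∈ Eᶜ | y ≤ (φ x : Fin n)} := by
    intro x
    refine card_bij (fun y _ => g y) (fun y hy => ?_) (fun y _ z _ h => hg.injective h)
      fun y hy => ?_
    · rw [mem_filter] at hy ⊢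
      have := g1 ⟨y, hy.1⟩
      simp only at this
      rw [this]
      exact ⟨(φ _).2, φ.monotone (a := ⟨y, hy.1⟩) hy.2⟩
    · rw [mem_filter] at hy
      have h1 := g2 ⟨y, hy.1⟩
      simp only at h1
      refine ⟨g y, ?_, hg y⟩
      rw [mem_filter, h1]
      refine ⟨(φ.symm _).2, ?_⟩
      have : φ.symm ⟨y, hy.1⟩ ≤ x := (φ.symm_apply_le).2 hy.2
      exact this
  -- If `φ x < x`, the complement has as many elements up to `φ x` as `E` has up to `x`, thus more
  -- than `E` has up to `φ x`, against `hb`.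
  have lt : ∀ x : E, (x : Fin n) < φ x := by
    intro x
    by_contra hc
    have hlt : (φ x : Fin n) < x := lt_of_le_of_ne (not_lt.1 hc) fun h => notMem x (h ▸ x.2)
    have h1 := hb ((φ x : Fin n) + 1)
    simp only [Nat.lt_succ_iff, ← Fin.le_def] at h1
    rw [← count] at h1
    have hss : {y ∈ E | y ≤ (φ x : Fin n)} ⊂ {y ∈ E | y ≤ (x : Fin n)} := by
      refine ⟨fun y hy => ?_, fun h => ?_⟩
      · rw [mem_filter] at hy ⊢
        exact ⟨hy.1, hy.2.trans hlt.le⟩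
      · have := h (show (x : Fin n) ∈ _ from mem_filter.2 ⟨x.2, le_rfl⟩)
        exact hlt.not_ge (mem_filter.1 this).2
    exact (card_lt_card hss).not_ge h1
  have lt' : ∀ x, x ∉ E → g x < x := by
    intro x h
    have h1 := g2 ⟨x, mem_compl.2 h⟩
    have h2 := lt (φ.symm ⟨x, mem_compl.2 h⟩)
    rw [φ.apply_symm_apply, ← h1] at h2
    exact h2
  have incE : ∀ x ∈ E, ∀ y ∈ E, x < y → g x < g y := by
    intro x hx y hy hxy
    have h1 := g1 ⟨x, hx⟩
    have h2 := g1 ⟨y, hy⟩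
    simp only at h1 h2
    rw [h1, h2]
    exact φ.strictMono (a := ⟨x, hx⟩) (b := ⟨y, hy⟩) hxy
  have incE' : ∀ x ∉ E, ∀ y ∉ E, x < y → g x < g y := by
    intro x hx y hy hxy
    have h1 := g2 ⟨x, mem_compl.2 hx⟩
    have h2 := g2 ⟨y, mem_compl.2 hy⟩
    simp only at h1 h2
    rw [h1, h2]
    exact φ.symm.strictMono (a := ⟨x, mem_compl.2 hx⟩) (b := ⟨y, mem_compl.2 hy⟩) hxy
  have ltE : ∀ x ∈ E, x < g x := fun x hx => by
    have := g1 ⟨x, hx⟩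
    simp only at this
    rw [this]
    exact lt ⟨x, hx⟩
  refine ⟨hg.toPerm, ⟨⟨hg, ?_⟩, fun x hx => ?_⟩, ?_⟩
  · rintro ⟨i, j, k, hij, hjk, hkj, hji⟩
    simp only [Function.Involutive.coe_toPerm] at hkj hji
    -- Two of the three places are both in `E` or both outside, and `g` increases on either set.
    by_cases hi : i ∈ E <;> by_cases hj : j ∈ E <;> by_cases hk : k ∈ E
    all_goals first
      | exact (incE i hi j hj hij).not_gt hji
      | exact (incE j hj k hk hjk).not_gt hkj
      | exact (incE i hi k hk (hij.trans hjk)).not_gt (hkj.trans hji)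
      | exact (incE' i hi j hj hij).not_gt hji
      | exact (incE' j hj k hk hjk).not_gt hkj
      | exact (incE' i hi k hk (hij.trans hjk)).not_gt (hkj.trans hji)
  · rw [Function.Involutive.coe_toPerm] at hx
    by_cases h : x ∈ E
    · exact (ltE x h).ne' hx
    · exact (lt' x h).ne hx
  · ext x
    rw [mem_excedances, Function.Involutive.coe_toPerm]
    exact ⟨fun h => by_contra fun hc => (lt' x hc).not_gt h, ltE x⟩

end Dyck

/-- The Dyck word of a fixed point free involution avoiding 321. -/
def dyckWord {k : ℕ} (π : fixedPointFree (2 * k)) : {p : DyckWord // p.semilength = k} :=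
  ⟨⟨stepWord (excedances π.1),
    by rw [count_U_stepWord, count_D_stepWord, card_compl_excedances π.2],
    fun i => by
      rw [count_U_take_stepWord, count_D_take_stepWord]
      exact ballot_excedances π.2 i⟩,
    by
      have := two_mul_card_excedances π.2
      rw [DyckWord.semilength, count_U_stepWord]
      omega⟩

theorem dyckWord_bijective {k : ℕ} : Function.Bijective (dyckWord (k := k)) := by
  constructor
  · intro π π' h
    have := congrArg (fun p => p.1.toList) h
    exact Subtype.ext (excedances_injOn π.2 π'.2 (stepWord_injective this))
  · rintro ⟨p, hp⟩
    have hlen : p.toList.length = 2 * k := by rw [← p.two_mul_semilength_eq_length, hp]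
    let E : Finset (Fin (2 * k)) := {i | p.toList[i]'(by omega) = DyckStep.U}
    have hE : stepWord E = p.toList := by
      refine List.ext_getElem (by simp [stepWord, hlen]) fun i h1 h2 => ?_
      rcases DyckStep.dichotomy (p.toList[i]) with h | h <;> simp [stepWord, E, h]
    obtain ⟨π, hπ, hexc⟩ := exists_excedances_eq (E := E)
      (by rw [← count_D_stepWord, ← count_U_stepWord, hE, p.count_U_eq_count_D])
      (fun i => by
        rw [← count_D_take_stepWord, ← count_U_take_stepWord, hE]
        exact p.count_D_le_count_U i)
    refine ⟨⟨π, hπ⟩, Subtype.ext (DyckWord.ext ?_)⟩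
    simp only [dyckWord, hexc, hE]

theorem ncard_fixedPointFree_two_mul (k : ℕ) : (fixedPointFree (2 * k)).ncard = catalan k := by
  rw [← DyckWord.card_dyckWord_semilength_eq_catalan, ← Nat.card_eq_fintype_card,
    ← Nat.card_coe_set_eq]
  exact Nat.card_eq_of_bijective _ dyckWord_bijective

theorem ncard_fixedPointFree_of_odd {n : ℕ} (h : ¬ Even n) : (fixedPointFree n).ncard = 0 := by
  rw [Set.ncard_eq_zero]
  refine Set.eq_empty_of_forall_notMem fun π hπ => h ?_
  rw [← two_mul_card_excedances hπ]
  exact even_two_mul _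

/-! ### Equations of the generating functions -/

theorem genFun_fixedPointFree :
    genFun fixedPointFree = 1 + X ^ 2 * genFun fixedPointFree ^ 2 := by
  have h : genFun fixedPointFree =
      expand 2 two_ne_zero (PowerSeries.map (Nat.castRingHom ℚ) catalanSeries) := by
    ext n
    rw [coeff_expand, genFun, coeff_mk]
    split_ifs with hn
    · obtain ⟨k, rfl⟩ := hn
      simp [ncard_fixedPointFree_two_mul]
    · rw [ncard_fixedPointFree_of_odd (fun h => hn h.two_dvd), Nat.cast_zero]
  have hc := congrArg (fun f => expand 2 two_ne_zero (PowerSeries.map (Nat.castRingHom ℚ) f))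
    catalanSeries_sq_mul_X_add_one
  simp only [map_add, map_mul, map_pow, map_one, PowerSeries.map_X, expand_X, ← h] at hc
  linear_combination -hc

theorem genFun_indec_fixedPointFree :
    genFun (indec fixedPointFree) = X ^ 2 * genFun fixedPointFree := by
  have h := sumClosed_fixedPointFree.genFun_eq
  have hne : genFun fixedPointFree ≠ 0 := by
    intro h0
    rw [h0, mul_zero, add_zero] at h
    exact zero_ne_one h
  refine mul_right_cancel₀ hne ?_
  linear_combination -h + genFun_fixedPointFree

theorem alphaGF_quadratic :
    alphaGF + alphaGF * X + alphaGF ^ 2 * X - X ^ 2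
        - 4 * alphaGF * X ^ 2 - 2 * alphaGF ^ 2 * X ^ 2 - 4 * X ^ 3
        - 4 * alphaGF * X ^ 3 - 4 * X ^ 4 = 0 := by
  have hF := genFun_fixedPointFree
  have hP := genFun_indec_fixedPointFree
  have hI := genFun_indec_I321
  have hA := genFun_I321_eq
  have hS := sumClosed_I321.genFun_eq
  generalize genFun fixedPointFree = F at *
  generalize genFun (indec fixedPointFree) = P at *
  generalize genFun (indec I321) = J at *
  generalize genFun I321 = S at *
  subst hP
  subst hI
  subst hA
  have h1 : alphaGF * (1 - X) = X ^ 2 * F * (1 + 2 * X + alphaGF) := by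
    linear_combination hS - X ^ 2 * hF
  -- With `W = 1 + 2 * X + alphaGF`, the equation `hF` times `X^2 W^2` contains `F` only through
  -- `X^2 F W`, which `h1` expresses by `alphaGF`.
  linear_combination (1 + 2 * X + alphaGF - alphaGF * (1 - X) - X ^ 2 * F * (1 + 2 * X + alphaGF))
    * h1 + X ^ 2 * (1 + 2 * X + alphaGF) ^ 2 * hF

theorem coeff_zetaGF_add (n : ℕ) :
    coeff n zetaGF + (if 0 < n ∧ Even n then 1 else 0) =
      coeff n (X ^ 2 * genFun fixedPointFree) := by
  rw [← genFun_indec_fixedPointFree]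
  simp only [zetaGF, gammaGF, deltaGF, genFun, map_add, coeff_mk]
  rw [← ncard_simpleInv_add, ncard_skewDecomposable]
  push_cast
  rfl

theorem coeff_zero_zetaGF : coeff 0 zetaGF = 0 := by
  simpa [coeff_X_pow_mul'] using coeff_zetaGF_add 0

theorem coeff_odd_zetaGF (m : ℕ) : coeff (2 * m + 1) zetaGF = 0 := by
  have h := coeff_zetaGF_add (2 * m + 1)
  rw [if_neg (fun h => Nat.not_even_two_mul_add_one m h.2), add_zero, coeff_X_pow_mul'] at h
  rw [h]
  split_ifs with hm
  · rw [genFun, coeff_mk, ncard_fixedPointFree_of_odd, Nat.cast_zero]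
    rw [Nat.even_sub hm]
    simp
  · rfl

theorem coeff_even_zetaGF (m : ℕ) : coeff (2 * m + 2) zetaGF = (catalan m : ℚ) - 1 := by
  have h := coeff_zetaGF_add (2 * m + 2)
  rw [if_pos ⟨by omega, by simp [Nat.even_add]⟩, coeff_X_pow_mul', if_pos (by omega),
    Nat.add_sub_cancel, genFun, coeff_mk, ncard_fixedPointFree_two_mul] at h
  linarith

theorem zetaGF_quadratic :
    (-1 + 4 * X ^ 2 - 3 * X ^ 4) * zetaGF
        + (1 - 2 * X ^ 2 + X ^ 4) * zetaGF ^ 2 + X ^ 6 = 0 := by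
  have hF := genFun_fixedPointFree
  have h1 : (1 - X ^ 2) * (X ^ 2 * genFun fixedPointFree) = (1 - X ^ 2) * zetaGF + X ^ 2 := by
    -- The series `X^2/(1 - X^2)` of the skew decomposable elements.
    let K : ℚ⟦X⟧ := PowerSeries.mk fun n => if 0 < n ∧ Even n then 1 else 0
    have hK : zetaGF + K = X ^ 2 * genFun fixedPointFree := by
      ext n
      rw [← coeff_zetaGF_add, map_add, coeff_mk]
    have hK' : K = X ^ 2 + X ^ 2 * K := by
      ext n
      rw [map_add, coeff_X_pow, coeff_X_pow_mul', coeff_mk, coeff_mk]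
      match n with
      | 0 => simp
      | 1 => simp
      | 2 => simp
      | n + 3 => simp [Nat.even_add, show n + 3 - 2 = n + 1 by omega, parity_simps]
    linear_combination (X ^ 2 - 1) * hK + hK'
  generalize genFun fixedPointFree = F at *
  linear_combination -(1 - X ^ 2) ^ 2 * X ^ 2 * hF + ((1 - X ^ 2) - (1 - X ^ 2) * (X ^ 2 * F) -
    ((1 - X ^ 2) * zetaGF + X ^ 2)) * h1

/-! ### Algebraicity, closed forms and initial coefficients -/

theorem coe_ofNat (k : ℕ) [k.AtLeastTwo] :
    ((ofNat(k) : Polynomial ℚ) : ℚ⟦X⟧) = ofNat(k) :=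
  map_ofNat Polynomial.coeToPowerSeries.ringHom k

theorem isAlgebraic_of_quadratic {y : ℚ⟦X⟧} (a b c : Polynomial ℚ) (ha : a ≠ 0)
    (h : (a : ℚ⟦X⟧) * y ^ 2 + b * y + c = 0) : IsAlgebraic (Polynomial ℚ) y := by
  refine ⟨Polynomial.C a * Polynomial.X ^ 2 + Polynomial.C b * Polynomial.X + Polynomial.C c,
    fun h0 => ha ?_, ?_⟩
  · have := congrArg (fun p => Polynomial.coeff p 2) h0
    simpa [Polynomial.coeff_X, Polynomial.coeff_C] using this
  · simpa [PowerSeries.algebraMap_apply'] using h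

theorem isAlgebraic_alphaGF : IsAlgebraic (Polynomial ℚ) alphaGF := by
  refine isAlgebraic_of_quadratic (Polynomial.X - 2 * Polynomial.X ^ 2)
    (1 + Polynomial.X - 4 * Polynomial.X ^ 2 - 4 * Polynomial.X ^ 3)
    (-Polynomial.X ^ 2 - 4 * Polynomial.X ^ 3 - 4 * Polynomial.X ^ 4) (fun h => ?_) ?_
  · have := congrArg (fun p => Polynomial.coeff p 1) h
    simp [Polynomial.coeff_X_pow, Polynomial.coeff_ofNat_mul] at this
  · have := alphaGF_quadratic
    push_cast [coe_ofNat]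
    linear_combination this

theorem isAlgebraic_zetaGF : IsAlgebraic (Polynomial ℚ) zetaGF := by
  refine isAlgebraic_of_quadratic (1 - 2 * Polynomial.X ^ 2 + Polynomial.X ^ 4)
    (-1 + 4 * Polynomial.X ^ 2 - 3 * Polynomial.X ^ 4) (Polynomial.X ^ 6) (fun h => ?_) ?_
  · have := congrArg (fun p => Polynomial.coeff p 0) h
    simp at this
  · have := zetaGF_quadratic
    push_cast [coe_ofNat]
    linear_combination this

theorem coe_eq_div {y a b : ℚ⟦X⟧} (hb : b ≠ 0) (h : y * b = a) :
    (y : LaurentSeries ℚ) = (a : LaurentSeries ℚ) / (b : LaurentSeries ℚ) := by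
  rw [eq_div_iff, ← PowerSeries.coe_mul, h]
  intro h0
  exact hb (HahnSeries.ofPowerSeries_injective (h0.trans PowerSeries.coe_zero.symm))

/-- If `a y^2 + b y + c = 0`, then `2 a y + b` squares to the discriminant; it serves as `s`. The
quotient is taken in Laurent series because `a` has constant term 0. -/
theorem exists_sqrt_alphaGF :
    ∃ s : ℚ⟦X⟧,
      IsSqrt (1 + 2 * X - 7 * X ^ 2 - 12 * X ^ 3 + 16 * X ^ 4 + 16 * X ^ 5
        - 16 * X ^ 6) s ∧
      (alphaGF : LaurentSeries ℚ) =
        ((1 + X - 4 * X ^ 2 - 4 * X ^ 3 - s : ℚ⟦X⟧) : LaurentSeries ℚ) /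
          ((2 * (-X + 2 * X ^ 2) : ℚ⟦X⟧) : LaurentSeries ℚ) := by
  refine ⟨1 + X - 4 * X ^ 2 - 4 * X ^ 3 - 2 * (-X + 2 * X ^ 2) * alphaGF, ⟨?_, ?_⟩,
    coe_eq_div ?_ (by ring)⟩
  · linear_combination 4 * (X - 2 * X ^ 2) * alphaGF_quadratic
  · simp
  · have h : (2 * (-X + 2 * X ^ 2) : ℚ⟦X⟧) = X * (-2 + 4 * X) := by ring
    rw [h]
    refine mul_ne_zero X_ne_zero fun h0 => ?_
    have := congrArg constantCoeff h0
    simp [map_ofNat] at this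

theorem exists_sqrt_zetaGF :
    ∃ s : ℚ⟦X⟧,
      IsSqrt (1 - 8 * X ^ 2 + 22 * X ^ 4 - 28 * X ^ 6 + 17 * X ^ 8 - 4 * X ^ 10) s ∧
      (zetaGF : LaurentSeries ℚ) =
        ((1 - 4 * X ^ 2 + 3 * X ^ 4 - s : ℚ⟦X⟧) : LaurentSeries ℚ) /
          ((2 * (1 - 2 * X ^ 2 + X ^ 4) : ℚ⟦X⟧) : LaurentSeries ℚ) := by
  -- Here `s` is `-(2 a y + b)`, as `b` has constant term `-1`.
  refine ⟨1 - 4 * X ^ 2 + 3 * X ^ 4 - 2 * (1 - 2 * X ^ 2 + X ^ 4) * zetaGF, ⟨?_, ?_⟩,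
    coe_eq_div ?_ (by ring)⟩
  · linear_combination 4 * (1 - 2 * X ^ 2 + X ^ 4) * zetaGF_quadratic
  · have h0 : constantCoeff zetaGF = 0 := by
      simpa using coeff_zero_zetaGF
    simp [h0]
  · intro h0
    have := congrArg constantCoeff h0
    simp [map_ofNat] at this

/-- The expansion of `alphaGF` to order 20. -/
noncomputable def alphaTrunc : Polynomial ℚ :=
  Polynomial.X ^ 2 + 3 * Polynomial.X ^ 3 + 5 * Polynomial.X ^ 4 + 10 * Polynomial.X ^ 5
    + 18 * Polynomial.X ^ 6 + 35 * Polynomial.X ^ 7 + 65 * Polynomial.X ^ 8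
    + 126 * Polynomial.X ^ 9 + 238 * Polynomial.X ^ 10 + 462 * Polynomial.X ^ 11
    + 882 * Polynomial.X ^ 12 + 1716 * Polynomial.X ^ 13 + 3300 * Polynomial.X ^ 14
    + 6435 * Polynomial.X ^ 15 + 12441 * Polynomial.X ^ 16 + 24310 * Polynomial.X ^ 17
    + 47190 * Polynomial.X ^ 18 + 92378 * Polynomial.X ^ 19 + 179894 * Polynomial.X ^ 20

/-- The quadratic at `alphaGF` minus the quadratic at the truncation `T` is `alphaGF - T` times a
series with constant term 1. So it suffices that `T` solves the equation modulo `X^21`; `r` is the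
explicit cofactor. -/
theorem X_pow_dvd_alphaGF_sub : (X : ℚ⟦X⟧) ^ 21 ∣ alphaGF - alphaTrunc := by
  have hA := alphaGF_quadratic
  obtain ⟨T, hTdef⟩ : ∃ T : ℚ⟦X⟧, T = alphaTrunc := ⟨_, rfl⟩
  rw [← hTdef]
  have hT : ∃ r : ℚ⟦X⟧, (T + T * X + T ^ 2 * X
      - X ^ 2 - 4 * T * X ^ 2 - 2 * T ^ 2 * X ^ 2 - 4 * X ^ 3
      - 4 * T * X ^ 3 - 4 * X ^ 4 : ℚ⟦X⟧) = X ^ 21 * r := by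
    refine ⟨-352716 - 1041352 * X - 629850 * X ^ 2 - 537472 * X ^ 3 - 1765518 * X ^ 4
      - 2779092 * X ^ 5 - 5485832 * X ^ 6 - 9436768 * X ^ 7 - 17963968 * X ^ 8
      - 32062272 * X ^ 9 - 60738535 * X ^ 10 - 110668844 * X ^ 11 - 209912703 * X ^ 12
      - 387645258 * X ^ 13 - 737252516 * X ^ 14 - 1374562904 * X ^ 15 - 2621888984 * X ^ 16
      - 4923792016 * X ^ 17 - 9418073236 * X ^ 18 - 17787685344 * X ^ 19
      - 34111140492 * X ^ 20 - 64723702472 * X ^ 21, ?_⟩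
    simp only [hTdef, alphaTrunc]
    push_cast [coe_ofNat]
    ring
  obtain ⟨r, hr⟩ := hT
  have hu : IsUnit ((1 + X - 4 * X ^ 2 - 4 * X ^ 3 +
      (X - 2 * X ^ 2) * (alphaGF + T)) : ℚ⟦X⟧) := by
    rw [PowerSeries.isUnit_iff_constantCoeff]
    simp
  rw [← hu.dvd_mul_right]
  refine ⟨-r, ?_⟩
  linear_combination hA - hr

theorem coeff_alphaGF {n : ℕ} (hn : n < 21) : coeff n alphaGF = alphaTrunc.coeff n := by
  have h := X_pow_dvd_iff.1 X_pow_dvd_alphaGF_sub n hn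
  rw [map_sub, sub_eq_zero] at h
  rw [h, Polynomial.coeff_coe]

theorem coeffs_alphaGF :
    (List.range 21).map (fun n => coeff n alphaGF) =
        [0, 0, 1, 3, 5, 10, 18, 35, 65, 126, 238, 462, 882, 1716, 3300, 6435, 12441, 24310,
          47190, 92378, 179894] := by
  rw [List.map_congr_left fun n hn => coeff_alphaGF (List.mem_range.1 hn)]
  simp [List.range_succ, alphaTrunc, Polynomial.coeff_X_pow, Polynomial.coeff_ofNat_mul]

end Inv321

theorem mainTheorem11 :
    -- the generating function of the sum decomposable involutions
    (IsAlgebraic (Polynomial ℚ) Inv321.alphaGF ∧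
      Inv321.alphaGF + Inv321.alphaGF * X + Inv321.alphaGF ^ 2 * X - X ^ 2
        - 4 * Inv321.alphaGF * X ^ 2 - 2 * Inv321.alphaGF ^ 2 * X ^ 2 - 4 * X ^ 3
        - 4 * Inv321.alphaGF * X ^ 3 - 4 * X ^ 4 = 0 ∧
      (∃ s : ℚ⟦X⟧,
        Inv321.IsSqrt (1 + 2 * X - 7 * X ^ 2 - 12 * X ^ 3 + 16 * X ^ 4 + 16 * X ^ 5
          - 16 * X ^ 6) s ∧
        (Inv321.alphaGF : LaurentSeries ℚ) =
          ((1 + X - 4 * X ^ 2 - 4 * X ^ 3 - s : ℚ⟦X⟧) : LaurentSeries ℚ) /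
            ((2 * (-X + 2 * X ^ 2) : ℚ⟦X⟧) : LaurentSeries ℚ)) ∧
      (List.range 21).map (fun n => PowerSeries.coeff n Inv321.alphaGF) =
        [0, 0, 1, 3, 5, 10, 18, 35, 65, 126, 238, 462, 882, 1716, 3300, 6435, 12441, 24310,
          47190, 92378, 179894]) ∧
    -- the generating function of the simple involutions of length > 2 and their inflations
    (IsAlgebraic (Polynomial ℚ) Inv321.zetaGF ∧
      (-1 + 4 * X ^ 2 - 3 * X ^ 4) * Inv321.zetaGF
        + (1 - 2 * X ^ 2 + X ^ 4) * Inv321.zetaGF ^ 2 + X ^ 6 = 0 ∧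
      (∃ s : ℚ⟦X⟧,
        Inv321.IsSqrt (1 - 8 * X ^ 2 + 22 * X ^ 4 - 28 * X ^ 6 + 17 * X ^ 8 - 4 * X ^ 10) s ∧
        (Inv321.zetaGF : LaurentSeries ℚ) =
          ((1 - 4 * X ^ 2 + 3 * X ^ 4 - s : ℚ⟦X⟧) : LaurentSeries ℚ) /
            ((2 * (1 - 2 * X ^ 2 + X ^ 4) : ℚ⟦X⟧) : LaurentSeries ℚ)) ∧
      PowerSeries.coeff 0 Inv321.zetaGF = 0 ∧
      (∀ m : ℕ, PowerSeries.coeff (2 * m + 1) Inv321.zetaGF = 0) ∧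
      (∀ m : ℕ, PowerSeries.coeff (2 * m + 2) Inv321.zetaGF = (catalan m : ℚ) - 1)) :=
  ⟨⟨Inv321.isAlgebraic_alphaGF, Inv321.alphaGF_quadratic, Inv321.exists_sqrt_alphaGF,
    Inv321.coeffs_alphaGF⟩, Inv321.isAlgebraic_zetaGF, Inv321.zetaGF_quadratic,
    Inv321.exists_sqrt_zetaGF, Inv321.coeff_zero_zetaGF, Inv321.coeff_odd_zetaGF,
    Inv321.coeff_even_zetaGF⟩
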